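/- A bounded linear operator $T$ on a Banach space $X$ is called $\mathcal U$-frequently hypercyclic if there is $x\in X$ such that for every non-empty open set $U\subseteq X$ the set $\{n\ge 0: T^n x\in U\}$ has positive upper density, where the upper density of $A\subseteq\mathbb N=\{0,1,2,\dots\}$ is $\limsup_{N\to\infty}\frac{\#(A\cap[0,N])}{N+1}$. **Theorem 4.5.** Let $1\le p<\infty$ and let $\ell^p(\mathbb N)$ be the complex sequence space with canonical basis $(e_k)_{k\ge0}$. (a) There exists an invertible bounded operator $T$ on $\ell^p(\mathbb N)$ such that $T$ is $\mathcal U$-frequently hypercyclic and $T^{-1}$ is not $\mathcal U$-frequently hypercyclic. (b) More explicitly, there is $C_0\in\mathbb N$ such that for every integer $C\ge C_0$, putting for $k\ge1$ $$\tau^{(k)}=2^{Ck^2},\quad \delta^{(k)}=2^{Ck^2+1},\quad \eta^{(k)}=2^{2Ck^2+1},\quad \Delta^{(k)}=2^{2Ck^2+k+4},$$ there are parameters $v,w,\varphi,b$ and an invertible bounded operator $S$ on $\ell^p(\mathbb N)$ such that $S$ is not $\mathcal U$-frequently hypercyclic, $S^{-1}$ is $\mathcal U$-frequently hypercyclic,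 and $S$ is the operator of $C^+$-type with these parameters, in the following sense. - (C-type parameters) $v=(v_n)_{n\ge1}$ are non-zero complex numbers with $\sum_n|v_n|<\infty$; $\varphi:\mathbb N\to\mathbb N$ satisfies $\varphi(0)=0$, $\varphi(n)<n$ for $n\ge1$, and every $\varphi^{-1}(l)$ is infinite; $b=(b_n)_{n\ge0}$ is a strictly increasing sequence of integers with $b_0=0$, and $b_{n+1}-b_n$ is a multiple of $2(b_{\varphi(n)+1}-b_{\varphi(n)})$ for $n\ge1$; $w=(w_k)_{k\ge1}$ are complex numbers with $0<\inf_k|w_k|\le\sup_k|w_k|<\infty$ and $\inf_n|W_n|>0$, where $W_n=\prod_{b_n<j<b_{n+1}}w_j$. - (C-type operator) $Se_k=w_{k+1}e_{k+1}$ if $b_n\le k<b_{n+1}-1$ for some $n\ge0$; $Se_{b_{n+1}-1}=v_ne_{b_{\varphi(n)}}-W_n^{-1}e_{b_n}$ for $n\ge1$; $Se_{b_1-1}=-W_0^{-1}e_0$. - ($C^+$-type with the given parameters) $W_n=1$ for all $n\ge0$, and for all $k\ge1$ and $n\in[2^{k-1},2^k)$: $\varphi(n)=n-2^{k-1}$,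 $b_{n+1}-b_n=\Delta^{(k)}$, $v_n=2^{-\tau^{(k)}}$, and, for $1\le i<\Delta^{(k)}$, writing $\delta,\eta,\Delta$ for $\delta^{(k)},\eta^{(k)},\Delta^{(k)}$, $$w_{b_n+i}=\begin{cases}\tfrac12 & 1\le i\le\delta,\\ 2&\delta<i\le2\delta,\\ 1&2\delta<i<\Delta-2\delta-2\eta,\\ \tfrac12&\Delta-2\delta-2\eta\le i<\Delta-\delta-2\eta,\\ 1&\Delta-\delta-2\eta\le i<\Delta-\delta-\eta,\\ 2&\Delta-\delta-\eta\le i<\Delta-\eta,\\ 1&\Delta-\eta\le i<\Delta.\end{cases}$$ In particular, the inverse of an invertible $\mathcal U$-frequently hypercyclic operator need not be $\mathcal U$-frequently hypercyclic. -/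

import Mathlib

open Filter
open scoped ENNReal

noncomputable section

namespace LinearDynamics

/-- Upper density of a set of non-negative integers:
`limsup_N #(A ∩ [0, N]) / (N + 1)`. The quotients lie in `[0, 1]`, so the real limsup is the
true one. -/
def upperDensity (A : Set ℕ) : ℝ :=
  limsup (fun N : ℕ => ((A ∩ Set.Iic N).ncard : ℝ) / ((N : ℝ) + 1)) atTop

/-- The return set `N_T(x, U) = {n ≥ 0 : T^n x ∈ U}`. -/
def returnSet {X : Type*} [NormedAddCommGroup X] [NormedSpace ℂ X]
    (T : X →L[ℂ] X) (x : X) (U : Set X) : Set ℕ :=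
  {n : ℕ | (T ^ n) x ∈ U}

/-- `T` is `𝒰`-frequently hypercyclic: some vector visits every non-empty open set along a set of
times of positive upper density. -/
def IsUFrequentlyHypercyclic {X : Type*} [NormedAddCommGroup X] [NormedSpace ℂ X]
    (T : X →L[ℂ] X) : Prop :=
  ∃ x : X, ∀ U : Set X, IsOpen U → U.Nonempty → 0 < upperDensity (returnSet T x U)

/-- The complex sequence space `ℓ^p(ℕ)`. -/
abbrev SeqSpace (p : ℝ≥0∞) : Type := lp (fun _ : ℕ => ℂ) p

/-- The canonical basis vector `e_k` of `ℓ^p(ℕ)`. -/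
def basisVec (p : ℝ≥0∞) (k : ℕ) : SeqSpace p := lp.single p k (1 : ℂ)

/-- `W_n = ∏_{b_n < j < b_{n+1}} w_j`. -/
def blockProd (w : ℕ → ℂ) (b : ℕ → ℕ) (n : ℕ) : ℂ :=
  ∏ j ∈ Finset.Ioo (b n) (b (n + 1)), w j

/-- The parameters `v, w, φ, b` of an operator of C-type. The values `v 0` and `w 0` play no
role. -/
structure CTypeData where
  v : ℕ → ℂ
  w : ℕ → ℂ
  φ : ℕ → ℕ
  b : ℕ → ℕ
  v_ne_zero : ∀ n, 1 ≤ n → v n ≠ 0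
  v_summable : Summable fun n => ‖v (n + 1)‖
  w_bounded_below : ∃ c : ℝ, 0 < c ∧ ∀ k, 1 ≤ k → c ≤ ‖w k‖
  w_bounded : ∃ c : ℝ, ∀ k, 1 ≤ k → ‖w k‖ ≤ c
  W_bounded_below : ∃ c : ℝ, 0 < c ∧ ∀ n, c ≤ ‖blockProd w b n‖
  φ_zero : φ 0 = 0
  φ_lt : ∀ n, 1 ≤ n → φ n < n
  φ_fiber_infinite : ∀ l, {n : ℕ | φ n = l}.Infinite
  b_zero : b 0 = 0
  b_strictMono : StrictMono b
  b_dvd : ∀ n, 1 ≤ n → 2 * (b (φ n + 1) - b (φ n)) ∣ b (n + 1) - b n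

/-- `W_n` for the given data. -/
def CTypeData.W (d : CTypeData) (n : ℕ) : ℂ := blockProd d.w d.b n

/-- `T` is the operator of C-type `T_{v,w,φ,b}` on `ℓ^p(ℕ)`. For `p < ∞` a bounded operator is
determined by these values on the basis vectors. -/
structure IsCTypeOperator {p : ℝ≥0∞} [Fact (1 ≤ p)] (d : CTypeData)
    (T : SeqSpace p →L[ℂ] SeqSpace p) : Prop where
  apply_inner : ∀ n k, d.b n ≤ k → k + 1 < d.b (n + 1) →
    T (basisVec p k) = d.w (k + 1) • basisVec p (k + 1)
  apply_last : ∀ n, 1 ≤ n →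
    T (basisVec p (d.b (n + 1) - 1)) =
      d.v n • basisVec p (d.b (d.φ n)) - (d.W n)⁻¹ • basisVec p (d.b n)
  apply_last_zero :
    T (basisVec p (d.b 1 - 1)) = -((d.W 0)⁻¹ • basisVec p 0)

/-- The data are of C⁺-type, with block sizes `Δ k`, constants `v' k` and weights `w' k i`
(`1 ≤ i < Δ k`) on the blocks with index in `[2^(k-1), 2^k)`, for `k ≥ 1`. -/
structure CTypeData.IsCPlus (d : CTypeData) (Δ : ℕ → ℕ) (v' : ℕ → ℂ) (w' : ℕ → ℕ → ℂ) :
    Prop where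
  φ_eq : ∀ k, 1 ≤ k → ∀ n ∈ Set.Ico (2 ^ (k - 1)) (2 ^ k), d.φ n = n - 2 ^ (k - 1)
  b_eq : ∀ k, 1 ≤ k → ∀ n ∈ Set.Ico (2 ^ (k - 1)) (2 ^ k), d.b (n + 1) - d.b n = Δ k
  v_eq : ∀ k, 1 ≤ k → ∀ n ∈ Set.Ico (2 ^ (k - 1)) (2 ^ k), d.v n = v' k
  w_eq : ∀ k, 1 ≤ k → ∀ n ∈ Set.Ico (2 ^ (k - 1)) (2 ^ k), ∀ i, 1 ≤ i → i < Δ k →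
    d.w (d.b n + i) = w' k i

/-- The weight in position `1 ≤ i < Δ` of a block, for parameters with `4 δ + 2 η < Δ`. -/
def weight (δ η Δ i : ℕ) : ℂ :=
  if i ≤ δ then 1 / 2
  else if i ≤ 2 * δ then 2
  else if i < Δ - 2 * δ - 2 * η then 1
  else if i < Δ - δ - 2 * η then 1 / 2
  else if i < Δ - δ - η then 1
  else if i < Δ - η then 2
  else 1

/-- `τ^(k) = 2^(C k²)`. -/
def tauParam (C k : ℕ) : ℕ := 2 ^ (C * k ^ 2)

/-- `δ^(k) = 2^(C k² + 1)`. -/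
def deltaParam (C k : ℕ) : ℕ := 2 ^ (C * k ^ 2 + 1)

/-- `η^(k) = 2^(2 C k² + 1)`. -/
def etaParam (C k : ℕ) : ℕ := 2 ^ (2 * C * k ^ 2 + 1)

/-- `Δ^(k) = 2^(2 C k² + k + 4)`. -/
def blockParam (C k : ℕ) : ℕ := 2 ^ (2 * C * k ^ 2 + k + 4)

/-- The data of C⁺-type of the example: `v^(k) = 2^(-τ^(k))`, the seven-step weights built from
`δ^(k), η^(k), Δ^(k)`, and `W_n = 1` for every `n ≥ 0` (for `n ≥ 1` this follows from the form of
the weights; for `n = 0` it normalizes the initial block). -/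
structure CTypeData.IsExample (d : CTypeData) (C : ℕ) : Prop where
  cPlus : d.IsCPlus (blockParam C) (fun k => (2 ^ tauParam C k : ℂ)⁻¹)
    (fun k i => weight (deltaParam C k) (etaParam C k) (blockParam C k) i)
  W_eq_one : ∀ n, d.W n = 1

end LinearDynamics

end

open Filter
open scoped ENNReal

noncomputable section

namespace LinearDynamics

/-! ### Parameters -/

/-! Each block carries a weighted cyclic shift that changes sign at every turn; its last vector also
feeds the start of the parent block with the tiny coefficient `coupling C n`. Write S for the
operator, e_n for `blockVec p C n`, and Δ, δ, η, τ, v for the parameters of block n. From S^Δ e_n =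
v e_parent − e_n and 2Δ_parent ∣ Δ one gets S^{2Δ} e_n = e_n, so finitely supported vectors are
periodic. On its own block the orbit of e_n has size 2^{-depth}: the depth reaches δ in a short dip
at the start and on a plateau of length η near the end, and the last η positions have depth 0.

Inverse: for u = S^i e_m take a child n of m of high level. Then z = v⁻¹ S^{δ+i} e_n lies in the dip
and has norm 2^{τ-δ+i} = 2^{i-τ}, while z − u = −v⁻¹ S^{Δ+δ+i} e_n. Applying S^{-t} brings this back
to the plateau for about η of the times t ≤ 2δ+2η (`absorbs_pow_blockVec`). With u = y − x₀, the
backward orbit of x₀ + z is near y at all multiples of the period of y in that window, a proportion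
independent of x₀; Baire category concludes (`isUFrequentlyHypercyclic_of_dense`).

Forward: expand x along the orbits of the e_n. Coefficients larger than 1 occur in arbitrarily high
blocks, since otherwise coordinate 0 of the orbit is bounded. In the last η positions of a far block
coefficients are just coordinates of x, hence small; so a large coefficient crosses η positions of
depth 0 before it reaches the dip, of length 2δ ≪ η, and later a plateau of length η ≪ Δ. Until a
higher block interferes, the orbit has norm at least 1/2 whenever the depth is 0
(`norm_orbit_apply_ge`), so it is rarely close to 0 (`two_pow_mul_card_le`). -/

lemma blockParam_eq (C k : ℕ) : blockParam C k = 2 ^ (k + 3) * etaParam C k := by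
  unfold blockParam etaParam
  rw [← pow_add]; congr 1; ring

lemma etaParam_pos (C k : ℕ) : 0 < etaParam C k := by unfold etaParam; positivity

lemma deltaParam_le_etaParam (C k : ℕ) : deltaParam C k ≤ etaParam C k := by
  unfold deltaParam etaParam
  apply Nat.pow_le_pow_right (by norm_num)
  rw [mul_assoc]; omega

/-- Keeps the seven zones of `weight` in order, so that none of its natural subtractions truncates.
-/
lemma four_delta_add_two_eta_lt (C k : ℕ) :
    4 * deltaParam C k + 2 * etaParam C k < blockParam C k := by
  have h1 := deltaParam_le_etaParam C k
  have h2 := etaParam_pos C k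
  have h3 : 8 * etaParam C k ≤ blockParam C k := by
    rw [blockParam_eq]
    apply Nat.mul_le_mul_right
    calc 8 = 2 ^ 3 := by norm_num
      _ ≤ 2 ^ (k + 3) := Nat.pow_le_pow_right (by norm_num) (by omega)
  omega

lemma deltaParam_eq_two_mul_tauParam (C k : ℕ) : deltaParam C k = 2 * tauParam C k := by
  unfold deltaParam tauParam
  rw [pow_succ, mul_comm]

lemma le_mul_sq {C k : ℕ} (hC : 10 ≤ C) : 10 * k ≤ C * k ^ 2 := by
  rcases Nat.eq_zero_or_pos k with rfl | hk
  · simp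
  · calc 10 * k ≤ C * k := Nat.mul_le_mul_right _ hC
      _ ≤ C * k ^ 2 := Nat.mul_le_mul_left _ (by nlinarith)

/-- The dip is negligible against η, even after multiplication by `2 ^ k`; both density estimates
use this. -/
lemma two_pow_mul_deltaParam_le {C k : ℕ} (hC : 10 ≤ C) (hk : 1 ≤ k) :
    2 ^ k * (2 * deltaParam C k) ≤ etaParam C k := by
  unfold deltaParam etaParam
  have := le_mul_sq (k := k) hC
  calc 2 ^ k * (2 * 2 ^ (C * k ^ 2 + 1)) = 2 ^ (k + (1 + (C * k ^ 2 + 1))) := by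
        ring
    _ ≤ _ := Nat.pow_le_pow_right (by norm_num) (by rw [mul_assoc]; omega)

lemma lt_tauParam {C k : ℕ} (hC : 10 ≤ C) : k < tauParam C k := by
  unfold tauParam
  have := le_mul_sq (k := k) hC
  exact (Nat.lt_two_pow_self).trans_le (Nat.pow_le_pow_right (by norm_num) (by omega))

/-- The coupling constants decay much faster than the block lengths grow. -/
lemma two_pow_add_le_tauParam {C k : ℕ} (hC : 10 ≤ C) (hk : 1 ≤ k) :
    2 ^ k + (2 * C * k ^ 2 + k + 4) + 3 ≤ tauParam C k := by
  unfold tauParam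
  have h := le_mul_sq (k := k) hC
  rw [mul_assoc 2 C]
  generalize C * k ^ 2 = m at *
  have hm : 10 ≤ m := by omega
  -- Each of `2 ^ k` and 2m + k + 7 ≤ 3m + 7 is at most half of `2 ^ m`.
  have h1 : 2 ^ k ≤ 2 ^ (m - 1) := Nat.pow_le_pow_right (by norm_num) (by omega)
  have h2 : ∀ j, 3 * (j + 10) + 7 ≤ 2 ^ (j + 9) := by
    intro j
    induction j with
    | zero => norm_num
    | succ j ih => rw [show j + 1 + 9 = (j + 9) + 1 by ring, pow_succ]; omega
  have h3 := h2 (m - 10)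
  rw [show m - 10 + 9 = m - 1 by omega] at h3
  have h4 : 2 ^ m = 2 ^ (m - 1) + 2 ^ (m - 1) := by
    rw [← two_mul, ← pow_succ']; congr 1; omega
  omega

/-! ### The weight profile inside a block -/

/-- The exponent `d` such that the product of the first `i` weights of a block is `2⁻ᵈ`. -/
def depth (δ η Δ i : ℕ) : ℕ :=
  if i ≤ δ then i
  else if i ≤ 2 * δ then 2 * δ - i
  else if i < Δ - 2 * δ - 2 * η then 0
  else if i < Δ - δ - 2 * η then i + 1 - (Δ - 2 * δ - 2 * η)
  else if i < Δ - δ - η then δ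
  else if i < Δ - η then Δ - η - 1 - i
  else 0

/-- The zone of `i + 1` decides the weight; `i` may lie in the previous zone, and the formulas for
`depth` match across the boundaries. -/
lemma depth_succ {δ η Δ i : ℕ} (h : 4 * δ + 2 * η < Δ) (hi : i + 1 < Δ) :
    (weight δ η Δ (i + 1) = 1 / 2 ∧ depth δ η Δ (i + 1) = depth δ η Δ i + 1) ∨
    (weight δ η Δ (i + 1) = 2 ∧ depth δ η Δ i = depth δ η Δ (i + 1) + 1) ∨
    (weight δ η Δ (i + 1) = 1 ∧ depth δ η Δ i = depth δ η Δ (i + 1)) := by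
  by_cases h1 : i + 1 ≤ δ
  · refine Or.inl ⟨by simp [weight, h1], ?_⟩
    unfold depth; split_ifs <;> omega
  by_cases h2 : i + 1 ≤ 2 * δ
  · refine Or.inr (Or.inl ⟨by simp only [weight, h1, h2, if_true, if_false], ?_⟩)
    unfold depth; split_ifs <;> omega
  by_cases h3 : i + 1 < Δ - 2 * δ - 2 * η
  · refine Or.inr (Or.inr ⟨by simp only [weight, h1, h2, h3, if_true, if_false], ?_⟩)
    unfold depth; split_ifs <;> omega
  by_cases h4 : i + 1 < Δ - δ - 2 * η
  · refine Or.inl ⟨by simp only [weight, h1, h2, h3, h4, if_true, if_false], ?_⟩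
    unfold depth; split_ifs <;> omega
  by_cases h5 : i + 1 < Δ - δ - η
  · refine Or.inr (Or.inr ⟨by simp only [weight, h1, h2, h3, h4, h5, if_true, if_false], ?_⟩)
    unfold depth; split_ifs <;> omega
  by_cases h6 : i + 1 < Δ - η
  · refine Or.inr (Or.inl ⟨by simp only [weight, h1, h2, h3, h4, h5, h6, if_true, if_false], ?_⟩)
    unfold depth; split_ifs <;> omega
  · refine Or.inr (Or.inr ⟨by simp only [weight, h1, h2, h3, h4, h5, h6, if_false], ?_⟩)
    unfold depth; split_ifs <;> omega

lemma weight_mem (δ η Δ i : ℕ) :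
    weight δ η Δ i = 1 / 2 ∨ weight δ η Δ i = 2 ∨ weight δ η Δ i = 1 := by
  unfold weight; split_ifs <;> simp

lemma half_le_norm_weight (δ η Δ i : ℕ) : 1 / 2 ≤ ‖weight δ η Δ i‖ := by
  rcases weight_mem δ η Δ i with h | h | h <;> rw [h] <;> norm_num

lemma norm_weight_le_two (δ η Δ i : ℕ) : ‖weight δ η Δ i‖ ≤ 2 := by
  rcases weight_mem δ η Δ i with h | h | h <;> rw [h] <;> norm_num

lemma weight_mul_pow_depth {δ η Δ i : ℕ} (h : 4 * δ + 2 * η < Δ) (hi : i + 1 < Δ) :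
    weight δ η Δ (i + 1) * (1 / 2 : ℂ) ^ depth δ η Δ i = (1 / 2 : ℂ) ^ depth δ η Δ (i + 1) := by
  rcases depth_succ h hi with ⟨h1, h2⟩ | ⟨h1, h2⟩ | ⟨h1, h2⟩
  · rw [h1, h2, pow_succ]; ring
  · rw [h1, h2, pow_succ]; ring
  · rw [h1, h2, one_mul]

/-! ### The block structure of `ℕ` -/

/-- The length of the `n`-th block. -/
def blockLen (C n : ℕ) : ℕ := blockParam C n.size

/-- The first index of the `n`-th block. -/
def blockStart (C n : ℕ) : ℕ := ∑ j ∈ Finset.range n, blockLen C j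

lemma blockLen_pos (C n : ℕ) : 0 < blockLen C n := by unfold blockLen blockParam; positivity

lemma blockStart_zero (C : ℕ) : blockStart C 0 = 0 := rfl

lemma blockStart_succ (C n : ℕ) : blockStart C (n + 1) = blockStart C n + blockLen C n :=
  Finset.sum_range_succ _ _

lemma blockStart_strictMono (C : ℕ) : StrictMono (blockStart C) :=
  strictMono_nat_of_lt_succ fun n => by rw [blockStart_succ]; have := blockLen_pos C n; omega

lemma exists_lt_blockStart (C κ : ℕ) : ∃ n, κ < blockStart C (n + 1) :=
  ⟨κ, (Nat.lt_succ_self κ).trans_le ((blockStart_strictMono C).le_apply)⟩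

/-- The block containing the index `κ`. -/
def blockOf (C κ : ℕ) : ℕ := Nat.find (exists_lt_blockStart C κ)

/-- The position of the index `κ` in its block. -/
def posOf (C κ : ℕ) : ℕ := κ - blockStart C (blockOf C κ)

lemma blockStart_blockOf_le (C κ : ℕ) : blockStart C (blockOf C κ) ≤ κ := by
  rcases Nat.eq_zero_or_pos (blockOf C κ) with h | h
  · rw [h, blockStart_zero]; omega
  · have := Nat.find_min (exists_lt_blockStart C κ) (m := blockOf C κ - 1)
      (by change _ < blockOf C κ; omega)
    rw [Nat.sub_add_cancel h] at this
    omega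

lemma blockStart_add_posOf (C κ : ℕ) : blockStart C (blockOf C κ) + posOf C κ = κ := by
  have := blockStart_blockOf_le C κ
  unfold posOf; omega

lemma posOf_lt (C κ : ℕ) : posOf C κ < blockLen C (blockOf C κ) := by
  have h1 := Nat.find_spec (exists_lt_blockStart C κ)
  change κ < blockStart C (blockOf C κ + 1) at h1
  rw [blockStart_succ] at h1
  have := blockStart_add_posOf C κ
  omega

lemma block_unique {C m n i j : ℕ} (hi : i < blockLen C m) (hj : j < blockLen C n)
    (h : blockStart C m + i = blockStart C n + j) : m = n ∧ i = j := by
  have key : ∀ {m n i j : ℕ}, i < blockLen C m →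
      blockStart C m + i = blockStart C n + j → ¬ m < n := by
    intro m n i j hi h hmn
    have := (blockStart_strictMono C).monotone (Nat.succ_le_of_lt hmn)
    rw [Nat.succ_eq_add_one, blockStart_succ] at this
    omega
  have : m = n := le_antisymm (not_lt.1 (key hj h.symm)) (not_lt.1 (key hi h))
  subst this
  exact ⟨rfl, by omega⟩

lemma blockOf_add {C n i : ℕ} (hi : i < blockLen C n) : blockOf C (blockStart C n + i) = n :=
  (block_unique (posOf_lt C _) hi (blockStart_add_posOf C _)).1

lemma posOf_add {C n i : ℕ} (hi : i < blockLen C n) : posOf C (blockStart C n + i) = i :=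
  (block_unique (posOf_lt C _) hi (blockStart_add_posOf C _)).2

lemma exists_block (C κ : ℕ) : ∃ n i, i < blockLen C n ∧ κ = blockStart C n + i :=
  ⟨_, _, posOf_lt C κ, (blockStart_add_posOf C κ).symm⟩

/-! ### The parent map -/

/-- The parent of a block: remove the leading binary digit of its index. -/
def parent (n : ℕ) : ℕ := n - 2 ^ (n.size - 1)

lemma size_eq_of_mem {k n : ℕ} (hk : 1 ≤ k) (hn : n ∈ Set.Ico (2 ^ (k - 1)) (2 ^ k)) :
    n.size = k := by
  have h1 : k - 1 < n.size := Nat.lt_size.2 hn.1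
  have h2 : n.size ≤ k := Nat.size_le.2 hn.2
  omega

lemma size_add_two_pow {m k : ℕ} (h : m < 2 ^ k) : (m + 2 ^ k).size = k + 1 :=
  size_eq_of_mem (by omega) ⟨by simp, by rw [pow_succ]; omega⟩

lemma parent_add_two_pow {m k : ℕ} (h : m < 2 ^ k) : parent (m + 2 ^ k) = m := by
  rw [parent, size_add_two_pow h]; simp

lemma two_pow_size_le {n : ℕ} (hn : 1 ≤ n) : 2 ^ (n.size - 1) ≤ n :=
  Nat.lt_size.1 (by have := Nat.size_pos.2 hn; omega)

lemma parent_lt {n : ℕ} (hn : 1 ≤ n) : parent n < n := by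
  have : 0 < 2 ^ (n.size - 1) := by positivity
  unfold parent; omega

lemma parent_lt_two_pow {n : ℕ} (hn : 1 ≤ n) : parent n < 2 ^ (n.size - 1) := by
  have h1 := Nat.lt_size_self n
  have h2 := two_pow_size_le hn
  have h3 := Nat.size_pos.2 hn
  have h4 : 2 ^ n.size = 2 ^ (n.size - 1) + 2 ^ (n.size - 1) := by
    rw [← two_mul, ← pow_succ']; congr 1; omega
  unfold parent; omega

lemma size_parent_lt {n : ℕ} (hn : 1 ≤ n) : (parent n).size < n.size := by
  have h1 := Nat.size_le.2 (parent_lt_two_pow hn)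
  have := Nat.size_pos.2 hn
  omega

/-- Lengths are powers of 2, and the summand `k` in the exponent makes them strictly increasing in
the level. -/
lemma two_mul_blockParam_dvd {C j k : ℕ} (h : j < k) :
    2 * blockParam C j ∣ blockParam C k := by
  unfold blockParam
  rw [← pow_succ']
  apply pow_dvd_pow
  have : 2 * C * j ^ 2 ≤ 2 * C * k ^ 2 := Nat.mul_le_mul_left _ (Nat.pow_le_pow_left h.le 2)
  omega

lemma two_mul_blockLen_parent_dvd {C n : ℕ} (hn : 1 ≤ n) :
    2 * blockLen C (parent n) ∣ blockLen C n :=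
  two_mul_blockParam_dvd (size_parent_lt hn)

/-! ### Weights, coupling constants and the data -/

/-- The weight at index `κ`. -/
def wt (C κ : ℕ) : ℂ :=
  weight (deltaParam C (blockOf C κ).size) (etaParam C (blockOf C κ).size)
    (blockLen C (blockOf C κ)) (posOf C κ)

/-- The product of the first `i` weights of block `n`. -/
def lam (C n i : ℕ) : ℂ :=
  (1 / 2 : ℂ) ^ depth (deltaParam C n.size) (etaParam C n.size) (blockLen C n) i

/-- The coupling constant of block `n`. -/
def coupling (C n : ℕ) : ℂ := if n = 0 then 0 else (2 ^ tauParam C n.size : ℂ)⁻¹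

lemma lam_ne_zero (C n i : ℕ) : lam C n i ≠ 0 := by exact pow_ne_zero _ (by norm_num)

lemma norm_lam (C n i : ℕ) : ‖lam C n i‖ =
    (1 / 2 : ℝ) ^ depth (deltaParam C n.size) (etaParam C n.size) (blockLen C n) i := by
  simp [lam]

lemma norm_lam_le_one (C n i : ℕ) : ‖lam C n i‖ ≤ 1 := by
  rw [norm_lam]; exact pow_le_one₀ (by norm_num) (by norm_num)

lemma lam_zero (C n : ℕ) : lam C n 0 = 1 := by simp [lam, depth]

lemma wt_mul_lam {C n i : ℕ} (hi : i + 1 < blockLen C n) :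
    wt C (blockStart C n + (i + 1)) * lam C n i = lam C n (i + 1) := by
  rw [wt, blockOf_add hi, posOf_add hi]
  exact weight_mul_pow_depth (four_delta_add_two_eta_lt C n.size) hi

lemma lam_last (C n : ℕ) : lam C n (blockLen C n - 1) = 1 := by
  have h := four_delta_add_two_eta_lt C n.size
  have h' := etaParam_pos C n.size
  change _ < blockLen C n at h
  have : depth (deltaParam C n.size) (etaParam C n.size) (blockLen C n) (blockLen C n - 1) = 0 := by
    unfold depth; split_ifs <;> omega
  rw [lam, this, pow_zero]

lemma prod_Ioo_wt (C n : ℕ) :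
    ∏ j ∈ Finset.Ioo (blockStart C n) (blockStart C (n + 1)), wt C j = 1 := by
  have key : ∀ i, i < blockLen C n →
      ∏ j ∈ Finset.Ioo (blockStart C n) (blockStart C n + (i + 1)), wt C j = lam C n i := by
    intro i
    induction i with
    | zero =>
      intro _
      rw [lam_zero, Finset.prod_eq_one]
      intro j hj
      rw [Finset.mem_Ioo] at hj
      omega
    | succ i ih =>
      intro hi
      rw [← wt_mul_lam hi, ← ih (by omega)]
      have : Finset.Ioo (blockStart C n) (blockStart C n + (i + 1 + 1)) =
          insert (blockStart C n + (i + 1))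
            (Finset.Ioo (blockStart C n) (blockStart C n + (i + 1))) := by
        ext; simp; omega
      rw [this, Finset.prod_insert (by simp)]
  have h := blockLen_pos C n
  have := key (blockLen C n - 1) (by omega)
  rw [lam_last, Nat.sub_add_cancel h] at this
  rwa [blockStart_succ]

/-- The length enters because every index of a block can feed its parent; the factor 8 brings the
total in `sum_range_couplingMajorant_le` down to 1/2. -/
lemma norm_coupling_mul_le {C : ℕ} (hC : 10 ≤ C) (n : ℕ) :
    ‖coupling C n‖ * (8 * blockLen C n) ≤ (1 / 2 : ℝ) ^ n := by
  rcases Nat.eq_zero_or_pos n with rfl | hn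
  · simp [coupling]
  have hk : 1 ≤ n.size := Nat.size_pos.2 hn
  have h := two_pow_add_le_tauParam hC hk
  have h2 : n < 2 ^ n.size := Nat.lt_size_self n
  rw [coupling, if_neg hn.ne', norm_inv, norm_pow, Complex.norm_ofNat, inv_mul_le_iff₀ (by positivity),
    one_div, inv_pow, ← div_eq_mul_inv, le_div_iff₀ (by positivity), blockLen, blockParam]
  push_cast
  calc (8 * 2 ^ (2 * C * n.size ^ 2 + n.size + 4) * 2 ^ n : ℝ)
      = 2 ^ (3 + (2 * C * n.size ^ 2 + n.size + 4) + n) := by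
        ring
    _ ≤ _ := pow_le_pow_right₀ (by norm_num) (by omega)

lemma norm_coupling_le {C : ℕ} (hC : 10 ≤ C) (n : ℕ) :
    ‖coupling C n‖ ≤ 1 / 8 * (1 / 2 : ℝ) ^ n := by
  have h := norm_coupling_mul_le hC n
  have h1 : (1 : ℝ) ≤ blockLen C n := by exact_mod_cast blockLen_pos C n
  have h2 := norm_nonneg (coupling C n)
  nlinarith

lemma summable_norm_coupling {C : ℕ} (hC : 10 ≤ C) : Summable fun n => ‖coupling C n‖ :=
  Summable.of_nonneg_of_le (fun _ => norm_nonneg _) (norm_coupling_le hC)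
    (summable_geometric_two.mul_left _)

lemma coupling_ne_zero {C n : ℕ} (hn : 1 ≤ n) : coupling C n ≠ 0 := by
  rw [coupling, if_neg (by omega)]; exact inv_ne_zero (pow_ne_zero _ (by norm_num))

/-- The parameters of the example. -/
def exampleData (C : ℕ) (hC : 10 ≤ C) : CTypeData where
  v := coupling C
  w := wt C
  φ := parent
  b := blockStart C
  v_ne_zero _ := coupling_ne_zero
  v_summable := (summable_nat_add_iff 1).2 (summable_norm_coupling hC)
  w_bounded_below := ⟨1 / 2, by norm_num, fun _ _ => half_le_norm_weight _ _ _ _⟩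
  w_bounded := ⟨2, fun _ _ => norm_weight_le_two _ _ _ _⟩
  W_bounded_below := ⟨1, one_pos, fun n => by rw [blockProd, prod_Ioo_wt, norm_one]⟩
  φ_zero := by simp [parent]
  φ_lt _ := parent_lt
  φ_fiber_infinite l := by
    -- Preimages of `l` arise by adding any leading binary digit larger than `l`.
    have hl (k : ℕ) : l < 2 ^ (l + k) :=
      Nat.lt_two_pow_self.trans_le (Nat.pow_le_pow_right (by norm_num) (by omega))
    refine Set.infinite_of_injective_forall_mem (f := fun k => l + 2 ^ (l + k)) ?_
      fun k => parent_add_two_pow (hl k)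
    intro a b hab
    have := Nat.pow_right_injective le_rfl (Nat.add_left_cancel hab)
    omega
  b_zero := rfl
  b_strictMono := blockStart_strictMono C
  b_dvd n hn := by
    simp only [blockStart_succ, Nat.add_sub_cancel_left]
    exact two_mul_blockLen_parent_dvd hn

lemma exampleData_isExample (C : ℕ) (hC : 10 ≤ C) : (exampleData C hC).IsExample C where
  cPlus :=
    { φ_eq := fun k hk n hn => by
        change parent n = _
        rw [parent, size_eq_of_mem hk hn]
      b_eq := fun k hk n hn => by
        change blockStart C (n + 1) - blockStart C n = _
        rw [blockStart_succ, Nat.add_sub_cancel_left, blockLen, size_eq_of_mem hk hn]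
      v_eq := fun k hk n hn => by
        have : n ≠ 0 := by have := hn.1; have : 0 < 2 ^ (k - 1) := by positivity
                           omega
        change coupling C n = _
        rw [coupling, if_neg this, size_eq_of_mem hk hn]
      w_eq := fun k hk n hn i _ hi => by
        have hs := size_eq_of_mem hk hn
        have hi' : i < blockLen C n := by rw [blockLen, hs]; exact hi
        change wt C (blockStart C n + i) = _
        rw [wt, blockOf_add hi', posOf_add hi', blockLen, hs] }
  W_eq_one := prod_Ioo_wt C

/-! ### Weighted permutation operators on `ℓ^p` -/

lemma basisVec_apply {p : ℝ≥0∞} (k j : ℕ) : basisVec p k j = if j = k then 1 else 0 := by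
  rw [basisVec, lp.single_apply, Pi.single_apply]

section WeightedPerm

variable {p : ℝ≥0∞} [Fact (1 ≤ p)]

lemma toReal_pos_of_ne_top (hp : p ≠ ⊤) : 0 < p.toReal :=
  ENNReal.toReal_pos (zero_lt_one.trans_le (Fact.out : 1 ≤ p)).ne' hp

lemma norm_basisVec (k : ℕ) : ‖basisVec p k‖ = 1 := by
  rw [basisVec, lp.norm_single (zero_lt_one.trans_le (Fact.out : 1 ≤ p)), norm_one]

lemma norm_coord_le (x : SeqSpace p) (k : ℕ) : ‖x k‖ ≤ ‖x‖ :=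
  lp.norm_apply_le_norm (zero_lt_one.trans_le (Fact.out : 1 ≤ p)).ne' x k

lemma hasSum_basisVec (hp : p ≠ ⊤) (x : SeqSpace p) :
    HasSum (fun k => x k • basisVec p k) x := by
  convert lp.hasSum_single hp x using 2 with k
  rw [basisVec, ← lp.single_smul, smul_eq_mul, mul_one]

/-- Stated for partial sums so that it yields both membership in `ℓ^p` and the operator bound. -/
lemma sum_norm_rpow_weightedPerm_le (hp : p ≠ ⊤) (σ : Equiv.Perm ℕ) (c : ℕ → ℂ) {M : ℝ}
    (hc : ∀ j, ‖c j‖ ≤ M) (x : SeqSpace p) (s : Finset ℕ) :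
    ∑ j ∈ s, ‖c j * x (σ j)‖ ^ p.toReal ≤ (M * ‖x‖) ^ p.toReal := by
  have hp0 := toReal_pos_of_ne_top hp
  have hM : 0 ≤ M := (norm_nonneg _).trans (hc 0)
  calc ∑ j ∈ s, ‖c j * x (σ j)‖ ^ p.toReal
      ≤ ∑ j ∈ s, M ^ p.toReal * ‖x (σ j)‖ ^ p.toReal := by
        refine Finset.sum_le_sum fun j _ => ?_
        rw [norm_mul, Real.mul_rpow (norm_nonneg _) (norm_nonneg _)]
        gcongr
        exact hc j
    _ = M ^ p.toReal * ∑ j ∈ s.map σ.toEmbedding, ‖x j‖ ^ p.toReal := by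
        rw [Finset.sum_map, Finset.mul_sum]; rfl
    _ ≤ M ^ p.toReal * ‖x‖ ^ p.toReal := by
        gcongr
        exact lp.sum_rpow_le_norm_rpow hp0 x _
    _ = _ := (Real.mul_rpow hM (norm_nonneg _)).symm

/-- The operator `(x_j) ↦ (c_j x_{σ j})` on `ℓ^p`. -/
def weightedPerm (hp : p ≠ ⊤) (σ : Equiv.Perm ℕ) (c : ℕ → ℂ) (M : ℝ) (hc : ∀ j, ‖c j‖ ≤ M) :
    SeqSpace p →L[ℂ] SeqSpace p :=
  LinearMap.mkContinuous
    { toFun := fun x => ⟨fun j => c j * x (σ j),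
        memℓp_gen' (sum_norm_rpow_weightedPerm_le hp σ c hc x)⟩
      map_add' := fun x y => by
        ext j; exact mul_add _ _ _
      map_smul' := fun a x => by
        ext j; exact mul_left_comm _ _ _ }
    M fun x => lp.norm_le_of_forall_sum_le (toReal_pos_of_ne_top hp)
      (mul_nonneg ((norm_nonneg _).trans (hc 0)) (norm_nonneg _))
      (sum_norm_rpow_weightedPerm_le hp σ c hc x)

lemma weightedPerm_apply (hp : p ≠ ⊤) (σ : Equiv.Perm ℕ) (c : ℕ → ℂ) (M : ℝ)
    (hc : ∀ j, ‖c j‖ ≤ M) (x : SeqSpace p) (j : ℕ) :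
    weightedPerm hp σ c M hc x j = c j * x (σ j) := rfl

lemma norm_weightedPerm_le (hp : p ≠ ⊤) (σ : Equiv.Perm ℕ) (c : ℕ → ℂ) (M : ℝ)
    (hc : ∀ j, ‖c j‖ ≤ M) : ‖weightedPerm hp σ c M hc‖ ≤ M :=
  LinearMap.mkContinuous_norm_le _ ((norm_nonneg _).trans (hc 0)) _

end WeightedPerm

/-! ### The cyclic permutation of the blocks -/

/-- The cyclic successor in the block. -/
def nextIdx (C κ : ℕ) : ℕ :=
  if posOf C κ + 1 = blockLen C (blockOf C κ) then blockStart C (blockOf C κ) else κ + 1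

/-- The cyclic predecessor in the block. -/
def prevIdx (C κ : ℕ) : ℕ :=
  if posOf C κ = 0 then blockStart C (blockOf C κ) + (blockLen C (blockOf C κ) - 1) else κ - 1

lemma nextIdx_inner {C n i : ℕ} (hi : i + 1 < blockLen C n) :
    nextIdx C (blockStart C n + i) = blockStart C n + (i + 1) := by
  rw [nextIdx, blockOf_add (by omega), posOf_add (by omega), if_neg (by omega)]; rfl

lemma nextIdx_last {C n i : ℕ} (hi : i + 1 = blockLen C n) :
    nextIdx C (blockStart C n + i) = blockStart C n := by
  rw [nextIdx, blockOf_add (by omega), posOf_add (by omega), if_pos hi]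

lemma prevIdx_succ {C n i : ℕ} (hi : i + 1 < blockLen C n) :
    prevIdx C (blockStart C n + (i + 1)) = blockStart C n + i := by
  rw [prevIdx, posOf_add hi, if_neg (by omega)]; rfl

lemma prevIdx_start (C n : ℕ) :
    prevIdx C (blockStart C n) = blockStart C n + (blockLen C n - 1) := by
  have h1 := blockOf_add (blockLen_pos C n)
  have h2 := posOf_add (blockLen_pos C n)
  rw [add_zero] at h1 h2
  rw [prevIdx, h1, h2, if_pos rfl]

/-- The permutation of `ℕ` moving each index to its cyclic predecessor in the block. -/
def blockPerm (C : ℕ) : Equiv.Perm ℕ where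
  toFun := prevIdx C
  invFun := nextIdx C
  left_inv κ := by
    obtain ⟨n, i, hi, rfl⟩ := exists_block C κ
    rcases i with _ | i
    · rw [add_zero, prevIdx_start, nextIdx_last (Nat.sub_add_cancel (blockLen_pos C n))]
    · rw [prevIdx_succ hi, nextIdx_inner hi]
  right_inv κ := by
    obtain ⟨n, i, hi, rfl⟩ := exists_block C κ
    by_cases h : i + 1 = blockLen C n
    · rw [nextIdx_last h, prevIdx_start, ← h]; rfl
    · rw [nextIdx_inner (by omega), prevIdx_succ (by omega)]

/-- The coefficient of the uncoupled operator arriving at the index `κ`. -/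
def arrivalCoeff (C κ : ℕ) : ℂ := if posOf C κ = 0 then -1 else wt C κ

lemma half_le_norm_arrivalCoeff (C κ : ℕ) : 1 / 2 ≤ ‖arrivalCoeff C κ‖ := by
  unfold arrivalCoeff
  split_ifs
  · norm_num
  · exact half_le_norm_weight _ _ _ _

lemma norm_arrivalCoeff_le (C κ : ℕ) : ‖arrivalCoeff C κ‖ ≤ 2 := by
  unfold arrivalCoeff
  split_ifs
  · norm_num
  · exact norm_weight_le_two _ _ _ _

lemma norm_inv_arrivalCoeff_le (C κ : ℕ) : ‖(arrivalCoeff C κ)⁻¹‖ ≤ 2 := by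
  rw [norm_inv]
  have := inv_anti₀ (by norm_num) (half_le_norm_arrivalCoeff C κ)
  norm_num at this ⊢
  exact this

lemma arrivalCoeff_ne_zero (C κ : ℕ) : arrivalCoeff C κ ≠ 0 := by
  rw [← norm_pos_iff]
  have := half_le_norm_arrivalCoeff C κ
  linarith

/-! ### The operator -/

section Operator

variable {p : ℝ≥0∞} [Fact (1 ≤ p)]

/-- The uncoupled operator as a unit of the algebra of bounded operators. -/
def cyclicUnit (hp : p ≠ ⊤) (C : ℕ) : (SeqSpace p →L[ℂ] SeqSpace p)ˣ where
  val := weightedPerm hp (blockPerm C) (arrivalCoeff C) 2 (norm_arrivalCoeff_le C)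
  inv := weightedPerm hp (blockPerm C).symm
    (fun κ => (arrivalCoeff C ((blockPerm C).symm κ))⁻¹) 2 fun _ => norm_inv_arrivalCoeff_le C _
  val_inv := by
    ext x j
    simp only [mul_apply_eq_comp, weightedPerm_apply, Equiv.symm_apply_apply,
      one_apply_eq_self]
    rw [mul_inv_cancel_left₀ (arrivalCoeff_ne_zero C j)]
  inv_val := by
    ext x j
    simp only [mul_apply_eq_comp, weightedPerm_apply, Equiv.apply_symm_apply,
      one_apply_eq_self]
    rw [inv_mul_cancel_left₀ (arrivalCoeff_ne_zero C _)]

lemma cyclicUnit_apply (hp : p ≠ ⊤) (C : ℕ) (x : SeqSpace p) (j : ℕ) :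
    (cyclicUnit hp C : SeqSpace p →L[ℂ] SeqSpace p) x j = arrivalCoeff C j * x (blockPerm C j) :=
  rfl

lemma norm_cyclicUnit_inv_le (hp : p ≠ ⊤) (C : ℕ) :
    ‖(↑(cyclicUnit hp C)⁻¹ : SeqSpace p →L[ℂ] SeqSpace p)‖ ≤ 2 :=
  norm_weightedPerm_le hp _ _ _ fun _ => norm_inv_arrivalCoeff_le C _

/-- The rank one operator coupling block `n` to its parent. -/
def couplingTerm (p : ℝ≥0∞) [Fact (1 ≤ p)] (C n : ℕ) : SeqSpace p →L[ℂ] SeqSpace p :=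
  coupling C n • (lp.evalCLM ℂ (fun _ : ℕ => ℂ) p (blockStart C n + (blockLen C n - 1))).smulRight
    (basisVec p (blockStart C (parent n)))

lemma couplingTerm_apply (C n : ℕ) (x : SeqSpace p) :
    couplingTerm p C n x = (coupling C n * x (blockStart C n + (blockLen C n - 1))) •
      basisVec p (blockStart C (parent n)) := by
  rw [mul_smul]; rfl

lemma norm_couplingTerm_le (C n : ℕ) : ‖couplingTerm p C n‖ ≤ ‖coupling C n‖ := by
  refine ContinuousLinearMap.opNorm_le_bound _ (norm_nonneg _) fun x => ?_
  rw [couplingTerm_apply, norm_smul, norm_basisVec, mul_one, norm_mul]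
  gcongr
  exact norm_coord_le _ _

lemma summable_norm_couplingTerm {C : ℕ} (hC : 10 ≤ C) :
    Summable fun n => ‖couplingTerm p C n‖ :=
  Summable.of_nonneg_of_le (fun _ => norm_nonneg _) (norm_couplingTerm_le C)
    (summable_norm_coupling hC)

/-- The coupling operator. -/
def couplingOp (p : ℝ≥0∞) [Fact (1 ≤ p)] (C : ℕ) : SeqSpace p →L[ℂ] SeqSpace p :=
  ∑' n, couplingTerm p C n

lemma norm_couplingOp_le {C : ℕ} (hC : 10 ≤ C) : ‖couplingOp p C‖ ≤ 1 / 4 := by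
  have hs : HasSum (fun n : ℕ => 1 / 8 * (1 / 2 : ℝ) ^ n) (1 / 4) := by
    have h := hasSum_geometric_two.mul_left (1 / 8 : ℝ)
    rwa [show (1 / 8 * 2 : ℝ) = 1 / 4 by norm_num] at h
  exact tsum_of_norm_bounded hs fun n => (norm_couplingTerm_le C n).trans (norm_coupling_le hC n)

lemma couplingOp_apply {C : ℕ} (hC : 10 ≤ C) (x : SeqSpace p) :
    HasSum (fun n => (coupling C n * x (blockStart C n + (blockLen C n - 1))) •
      basisVec p (blockStart C (parent n))) (couplingOp p C x) := by
  have h := (summable_norm_couplingTerm (p := p) hC).of_norm.hasSum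
  have := h.mapL (ContinuousLinearMap.apply ℂ (SeqSpace p) x)
  simp only [ContinuousLinearMap.apply_apply, couplingTerm_apply] at this
  exact this

/-- The coupled operator as a unit. -/
def opUnit (hp : p ≠ ⊤) {C : ℕ} (hC : 10 ≤ C) : (SeqSpace p →L[ℂ] SeqSpace p)ˣ :=
  (cyclicUnit hp C).add (couplingOp p C) (by
    have h1 := norm_couplingOp_le (p := p) hC
    have h2 := norm_cyclicUnit_inv_le hp C
    have : Nontrivial (SeqSpace p) :=
      ⟨basisVec p 0, 0, fun h => by have := norm_basisVec (p := p) 0; rw [h] at this; simp at this⟩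
    have h3 : 0 < ‖(↑(cyclicUnit hp C)⁻¹ : SeqSpace p →L[ℂ] SeqSpace p)‖ := Units.norm_pos _
    -- The perturbation has norm at most 1/4, below 1/2 ≤ ‖D⁻¹‖⁻¹ for the uncoupled operator D.
    have := inv_anti₀ h3 h2
    linarith)

/-- The operator of the example. -/
def exampleOp (hp : p ≠ ⊤) {C : ℕ} (hC : 10 ≤ C) : SeqSpace p ≃L[ℂ] SeqSpace p :=
  ContinuousLinearEquiv.ofUnit (opUnit hp hC)

lemma exampleOp_apply (hp : p ≠ ⊤) {C : ℕ} (hC : 10 ≤ C) (x : SeqSpace p) :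
    exampleOp hp hC x = (cyclicUnit hp C : SeqSpace p →L[ℂ] SeqSpace p) x + couplingOp p C x := rfl

lemma cyclicUnit_basisVec (hp : p ≠ ⊤) (C k : ℕ) :
    (cyclicUnit hp C : SeqSpace p →L[ℂ] SeqSpace p) (basisVec p k) =
      arrivalCoeff C (nextIdx C k) • basisVec p (nextIdx C k) := by
  ext j
  have h : blockPerm C j = k ↔ j = nextIdx C k := (blockPerm C).eq_symm_apply.symm
  rw [cyclicUnit_apply, lp.coeFn_smul, Pi.smul_apply, basisVec_apply, basisVec_apply, smul_eq_mul]
  simp only [h]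
  split_ifs with h'
  · rw [h']
  · simp

lemma exampleOp_basisVec_inner (hp : p ≠ ⊤) {C : ℕ} (hC : 10 ≤ C) {n i : ℕ}
    (hi : i + 1 < blockLen C n) :
    exampleOp hp hC (basisVec p (blockStart C n + i)) =
      wt C (blockStart C n + (i + 1)) • basisVec p (blockStart C n + (i + 1)) := by
  have h0 : couplingOp p C (basisVec p (blockStart C n + i)) = 0 := by
    refine (couplingOp_apply hC _).unique ?_
    convert hasSum_zero with m
    rw [basisVec_apply, if_neg, mul_zero, zero_smul]
    intro h
    have hm := blockLen_pos C m
    obtain ⟨rfl, h⟩ := block_unique (by omega) (by omega) h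
    omega
  rw [exampleOp_apply, h0, add_zero, cyclicUnit_basisVec, nextIdx_inner hi, arrivalCoeff,
    posOf_add hi, if_neg (by omega)]

lemma exampleOp_basisVec_last (hp : p ≠ ⊤) {C : ℕ} (hC : 10 ≤ C) (n : ℕ) :
    exampleOp hp hC (basisVec p (blockStart C n + (blockLen C n - 1))) =
      coupling C n • basisVec p (blockStart C (parent n)) - basisVec p (blockStart C n) := by
  have h0 : couplingOp p C (basisVec p (blockStart C n + (blockLen C n - 1))) =
      coupling C n • basisVec p (blockStart C (parent n)) := by
    refine (couplingOp_apply hC _).unique ?_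
    convert hasSum_single n ?_ using 1
    · rw [basisVec_apply, if_pos rfl, mul_one]
    intro m hm
    rw [basisVec_apply, if_neg, mul_zero, zero_smul]
    intro h
    have h1 := blockLen_pos C m
    have h2 := blockLen_pos C n
    exact hm (block_unique (by omega) (by omega) h).1
  have h1 := posOf_add (blockLen_pos C n)
  rw [add_zero] at h1
  rw [exampleOp_apply, h0, cyclicUnit_basisVec,
    nextIdx_last (Nat.sub_add_cancel (blockLen_pos C n)), arrivalCoeff, h1, if_pos rfl,
    neg_one_smul, sub_eq_add_neg, add_comm]

lemma isCTypeOperator_exampleOp (hp : p ≠ ⊤) {C : ℕ} (hC : 10 ≤ C) :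
    IsCTypeOperator (exampleData C hC)
      (exampleOp hp hC : SeqSpace p →L[ℂ] SeqSpace p) where
  apply_inner n k h1 h2 := by
    change blockStart C n ≤ k at h1
    change k + 1 < blockStart C (n + 1) at h2
    rw [blockStart_succ] at h2
    obtain ⟨i, rfl⟩ := Nat.exists_eq_add_of_le h1
    exact exampleOp_basisVec_inner hp hC (by omega)
  apply_last n hn := by
    have h := blockLen_pos C n
    have hW : (exampleData C hC).W n = 1 := prod_Ioo_wt C n
    have : (exampleData C hC).b (n + 1) - 1 = blockStart C n + (blockLen C n - 1) := by
      change blockStart C (n + 1) - 1 = _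
      rw [blockStart_succ]; omega
    rw [this, hW, inv_one, one_smul]
    exact exampleOp_basisVec_last hp hC n
  apply_last_zero := by
    have h := blockLen_pos C 0
    have hW : (exampleData C hC).W 0 = 1 := prod_Ioo_wt C 0
    have : (exampleData C hC).b 1 - 1 = blockStart C 0 + (blockLen C 0 - 1) := by
      change blockStart C (0 + 1) - 1 = _
      rw [blockStart_succ]; omega
    rw [this, hW, inv_one, one_smul]
    -- Block 0 is its own parent, but its coupling constant is 0 by convention.
    have := exampleOp_basisVec_last hp hC 0
    rwa [coupling, if_pos rfl, zero_smul, zero_sub] at this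

/-! ### Orbits of the block vectors -/

/-- The first basis vector of block `n`. -/
def blockVec (p : ℝ≥0∞) (C n : ℕ) : SeqSpace p := basisVec p (blockStart C n)

/-- The operator of the example as a bounded linear map. -/
def exampleCLM (hp : p ≠ ⊤) {C : ℕ} (hC : 10 ≤ C) : SeqSpace p →L[ℂ] SeqSpace p :=
  (exampleOp hp hC : SeqSpace p →L[ℂ] SeqSpace p)

variable (hp : p ≠ ⊤) {C : ℕ} (hC : 10 ≤ C)

lemma pow_add_apply (T : SeqSpace p →L[ℂ] SeqSpace p) (m n : ℕ) (x : SeqSpace p) :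
    (T ^ (m + n)) x = (T ^ m) ((T ^ n) x) := by
  rw [pow_add]; rfl

lemma pow_blockVec_of_lt {n i : ℕ} (hi : i < blockLen C n) :
    (exampleCLM hp hC ^ i) (blockVec p C n) = lam C n i • basisVec p (blockStart C n + i) := by
  induction i with
  | zero => rw [lam_zero, one_smul]; rfl
  | succ i ih =>
    rw [add_comm i 1, pow_add_apply, ih (by omega), pow_one, map_smul, exampleCLM]
    change lam C n i • exampleOp hp hC _ = _
    rw [exampleOp_basisVec_inner hp hC hi, smul_smul, mul_comm, wt_mul_lam hi, add_comm 1 i]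

lemma pow_blockLen_blockVec (n : ℕ) :
    (exampleCLM hp hC ^ blockLen C n) (blockVec p C n) =
      coupling C n • blockVec p C (parent n) - blockVec p C n := by
  have h := blockLen_pos C n
  have h1 : blockLen C n = 1 + (blockLen C n - 1) := by omega
  conv_lhs => rw [h1, pow_add_apply, pow_blockVec_of_lt hp hC (by omega), lam_last, one_smul]
  exact exampleOp_basisVec_last hp hC n

lemma pow_apply_eq_of_dvd {T : SeqSpace p →L[ℂ] SeqSpace p} {x : SeqSpace p} {m n : ℕ}
    (h : (T ^ m) x = x) (hd : m ∣ n) : (T ^ n) x = x := by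
  obtain ⟨q, rfl⟩ := hd
  induction q with
  | zero => simp
  | succ q ih => rw [Nat.mul_succ, pow_add_apply, h, ih]

/-- The length of block `n` is a multiple of the period of its parent, so the two parent terms of
consecutive turns cancel. -/
lemma pow_two_mul_blockLen_blockVec (n : ℕ) :
    (exampleCLM hp hC ^ (2 * blockLen C n)) (blockVec p C n) = blockVec p C n := by
  induction n using Nat.strong_induction_on with
  | _ n ih =>
    rw [two_mul, pow_add_apply, pow_blockLen_blockVec, map_sub, map_smul, pow_blockLen_blockVec]
    rcases Nat.eq_zero_or_pos n with rfl | hn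
    · simp [coupling]
    · rw [pow_apply_eq_of_dvd (ih _ (parent_lt hn)) (two_mul_blockLen_parent_dvd hn)]
      abel

/-- Full description of the orbit of a block vector: up to sign it stays on its own block, and
during every second turn it also feeds the orbit of the parent block. -/
lemma pow_blockVec (n r : ℕ) :
    (exampleCLM hp hC ^ r) (blockVec p C n) =
      if Even (r / blockLen C n) then
        lam C n (r % blockLen C n) • basisVec p (blockStart C n + r % blockLen C n)
      else coupling C n • (exampleCLM hp hC ^ (r % blockLen C n)) (blockVec p C (parent n)) -
        lam C n (r % blockLen C n) • basisVec p (blockStart C n + r % blockLen C n) := by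
  have hmod := Nat.mod_lt r (blockLen_pos C n)
  have hr := Nat.mod_add_div r (blockLen C n)
  have h2 := pow_two_mul_blockLen_blockVec (p := p) hp hC n
  rw [← pow_blockVec_of_lt hp hC hmod]
  split_ifs with h
  · obtain ⟨q, hq⟩ := h
    conv_lhs => rw [← hr, pow_add_apply, pow_apply_eq_of_dvd h2 ⟨q, by rw [hq]; ring⟩]
  · obtain ⟨q, hq⟩ := Nat.not_even_iff_odd.1 h
    conv_lhs =>
      rw [← hr, hq, show blockLen C n * (2 * q + 1) = blockLen C n + 2 * blockLen C n * q by ring,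
        pow_add_apply, pow_add_apply, pow_apply_eq_of_dvd h2 ⟨q, rfl⟩, pow_blockLen_blockVec,
        map_sub, map_smul]

end Operator

/-! ### Upper density -/

lemma ncard_inter_Iic_le (A : Set ℕ) (N : ℕ) : (A ∩ Set.Iic N).ncard ≤ N + 1 := by
  calc (A ∩ Set.Iic N).ncard ≤ (Set.Iic N).ncard :=
        Set.ncard_le_ncard Set.inter_subset_right (Set.finite_Iic N)
    _ = N + 1 := by rw [← Nat.card_coe_set_eq]; simp

lemma density_quotient_le_one (A : Set ℕ) (N : ℕ) :
    ((A ∩ Set.Iic N).ncard : ℝ) / ((N : ℝ) + 1) ≤ 1 := by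
  rw [div_le_one (by positivity)]
  exact_mod_cast ncard_inter_Iic_le A N

lemma le_upperDensity {A : Set ℕ} {c : ℝ}
    (h : ∀ N₀ : ℕ, ∃ N, N₀ ≤ N ∧ c ≤ ((A ∩ Set.Iic N).ncard : ℝ) / ((N : ℝ) + 1)) :
    c ≤ upperDensity A := by
  refine le_limsup_of_frequently_le (frequently_atTop.2 fun N₀ => ?_) ?_
  · obtain ⟨N, h1, h2⟩ := h N₀
    exact ⟨N, h1, h2⟩
  · exact isBoundedUnder_of ⟨1, density_quotient_le_one A⟩

lemma upperDensity_le {A : Set ℕ} {c d : ℝ}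
    (h : ∀ N : ℕ, ((A ∩ Set.Iic N).ncard : ℝ) ≤ c * ((N : ℝ) + 1) + d) :
    upperDensity A ≤ c := by
  have hlim : Tendsto (fun N : ℕ => c + d / ((N : ℝ) + 1)) atTop (nhds (c + 0)) :=
    tendsto_const_nhds.add (tendsto_const_nhds.div_atTop
      (tendsto_atTop_add_const_right _ _ tendsto_natCast_atTop_atTop))
  rw [← add_zero c, ← hlim.limsup_eq]
  refine limsup_le_limsup (Eventually.of_forall fun N => ?_)
    (isBoundedUnder_of ⟨0, fun N => by positivity⟩).isCoboundedUnder_le hlim.isBoundedUnder_le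
  have hN : (0 : ℝ) < (N : ℝ) + 1 := by positivity
  change _ / _ ≤ _
  rw [div_le_iff₀ hN, add_mul, div_mul_cancel₀ _ hN.ne']
  exact h N

/-! ### A Baire category criterion -/

section Criterion

variable {X : Type*} [NormedAddCommGroup X] [NormedSpace ℂ X]

/-- Finitely many visits to an open set persist under small perturbations of `x`. -/
lemma isOpen_setOf_lt_ncard_returnSet (T : X →L[ℂ] X) {V : Set X} (hV : IsOpen V) (N : ℕ) (c : ℝ) :
    IsOpen {x | c < ((returnSet T x V ∩ Set.Iic N).ncard : ℝ) / ((N : ℝ) + 1)} := by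
  rw [isOpen_iff_mem_nhds]
  intro x hx
  have hfin : (returnSet T x V ∩ Set.Iic N).Finite := (Set.finite_Iic N).inter_of_right _
  have : (⋂ t ∈ returnSet T x V ∩ Set.Iic N, (T ^ t) ⁻¹' V) ∈ nhds x :=
    (Filter.biInter_mem hfin).2 fun t ht => (hV.preimage (T ^ t).continuous).mem_nhds ht.1
  filter_upwards [this] with y hy
  refine lt_of_lt_of_le hx ?_
  exact div_le_div_of_nonneg_right (Nat.cast_le.2 (Set.ncard_le_ncard
    (fun t ht => ⟨Set.mem_iInter₂.1 hy t ht, ht.2⟩) ((Set.finite_Iic N).inter_of_right _)))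
    (by positivity)

/-- If the visits to each open set have a proportion bounded below along arbitrarily long
initial segments, on a dense set of vectors, then the operator is `𝒰`-frequently hypercyclic. -/
lemma isUFrequentlyHypercyclic_of_dense [CompleteSpace X] [SecondCountableTopology X]
    (T : X →L[ℂ] X)
    (h : ∀ V : Set X, IsOpen V → V.Nonempty → ∃ c : ℝ, 0 < c ∧
      ∀ U : Set X, IsOpen U → U.Nonempty → ∀ N₀ : ℕ, ∃ x ∈ U, ∃ N, N₀ ≤ N ∧
        c < ((returnSet T x V ∩ Set.Iic N).ncard : ℝ) / ((N : ℝ) + 1)) :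
    IsUFrequentlyHypercyclic T := by
  have hB : ∀ V : TopologicalSpace.countableBasis X, IsOpen (V : Set X) ∧ (V : Set X).Nonempty :=
    fun V => ⟨TopologicalSpace.isOpen_of_mem_countableBasis V.2,
      TopologicalSpace.nonempty_of_mem_countableBasis V.2⟩
  -- The constant depends on `V` alone, so it survives the intersection over all starting times
  -- `N₀`.
  choose c hc0 hc using fun V : TopologicalSpace.countableBasis X => h V (hB V).1 (hB V).2
  have : Countable (TopologicalSpace.countableBasis X) :=
    (TopologicalSpace.countable_countableBasis X).to_subtype
  let O : TopologicalSpace.countableBasis X × ℕ → Set X := fun q =>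
    ⋃ N, ⋃ _ : q.2 ≤ N, {x | c q.1 < ((returnSet T x q.1 ∩ Set.Iic N).ncard : ℝ) / ((N : ℝ) + 1)}
  have hd : Dense (⋂ q, O q) := by
    refine dense_iInter_of_isOpen (fun q => ?_) fun q => ?_
    · exact isOpen_iUnion fun N => isOpen_iUnion fun _ =>
        isOpen_setOf_lt_ncard_returnSet T (hB q.1).1 N _
    · rw [dense_iff_inter_open]
      intro U hU hne
      obtain ⟨x, hx, N, hN, hcN⟩ := hc q.1 U hU hne q.2
      exact ⟨x, hx, Set.mem_iUnion₂.2 ⟨N, hN, hcN⟩⟩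
  obtain ⟨x, hx⟩ := hd.nonempty
  refine ⟨x, fun U hU ⟨y, hy⟩ => ?_⟩
  obtain ⟨V, hV, -, hVU⟩ :=
    (TopologicalSpace.isBasis_countableBasis X).exists_subset_of_mem_open hy hU
  refine (hc0 ⟨V, hV⟩).trans_le (le_upperDensity fun N₀ => ?_)
  obtain ⟨N, hN, hcN⟩ := Set.mem_iUnion₂.1 (Set.mem_iInter.1 hx (⟨V, hV⟩, N₀))
  refine ⟨N, hN, le_trans (le_of_lt hcN) ?_⟩
  gcongr
  · exact (Set.finite_Iic N).inter_of_right _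
  · exact fun t ht => hVU ht

end Criterion

/-! ### Density of the finitely supported vectors -/

section Span

variable {p : ℝ≥0∞} [Fact (1 ≤ p)]

lemma dense_span_basisVec (hp : p ≠ ⊤) :
    Dense (Submodule.span ℂ (Set.range (basisVec p)) : Set (SeqSpace p)) := fun x =>
  mem_closure_of_tendsto (hasSum_basisVec hp x) (Eventually.of_forall fun _ =>
    Submodule.sum_mem _ fun k _ => Submodule.smul_mem _ _ (Submodule.subset_span ⟨k, rfl⟩))

lemma secondCountableTopology_seqSpace (hp : p ≠ ⊤) : SecondCountableTopology (SeqSpace p) := by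
  have h : TopologicalSpace.IsSeparable (Set.univ : Set (SeqSpace p)) := by
    rw [← (dense_span_basisVec hp).closure_eq]
    exact ((Set.countable_range (basisVec p)).isSeparable.span (R := ℂ)).closure
  have : TopologicalSpace.SeparableSpace (SeqSpace p) := TopologicalSpace.isSeparable_univ_iff.1 h
  exact UniformSpace.secondCountable_of_separable _

end Span

/-! ### The inverse is `𝒰`-frequently hypercyclic -/

section Inverse

variable {p : ℝ≥0∞} [Fact (1 ≤ p)] (hp : p ≠ ⊤) {C : ℕ} (hC : 10 ≤ C)

/-- The inverse of the operator of the example. -/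
def inverseCLM : SeqSpace p →L[ℂ] SeqSpace p :=
  ((exampleOp hp hC).symm : SeqSpace p →L[ℂ] SeqSpace p)

lemma inverseCLM_pow_exampleCLM_pow (t r : ℕ) (x : SeqSpace p) :
    (inverseCLM hp hC ^ t) ((exampleCLM hp hC ^ (t + r)) x) = (exampleCLM hp hC ^ r) x := by
  induction t with
  | zero => simp
  | succ t ih =>
    rw [pow_add_apply, show t + 1 + r = 1 + (t + r) by ring, pow_add_apply, pow_one, pow_one, ← ih]
    congr 1
    exact (exampleOp hp hC).symm_apply_apply _

lemma inverseCLM_pow_of_periodic {x : SeqSpace p} {P t : ℕ} (h : (exampleCLM hp hC ^ P) x = x)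
    (ht : P ∣ t) : (inverseCLM hp hC ^ t) x = x := by
  have := inverseCLM_pow_exampleCLM_pow hp hC t 0 x
  rw [add_zero, pow_apply_eq_of_dvd h ht] at this
  simpa using this

/-- Every basis vector is a multiple of a point on the orbit of its block vector. -/
lemma exists_period {x : SeqSpace p} (hx : x ∈ Submodule.span ℂ (Set.range (basisVec p))) :
    ∃ P, 0 < P ∧ (exampleCLM hp hC ^ P) x = x := by
  induction hx using Submodule.span_induction with
  | mem x hx =>
    obtain ⟨κ, rfl⟩ := hx
    obtain ⟨n, i, hi, rfl⟩ := exists_block C κ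
    refine ⟨2 * blockLen C n, by have := blockLen_pos C n; omega, ?_⟩
    have h : basisVec p (blockStart C n + i) =
        (lam C n i)⁻¹ • (exampleCLM hp hC ^ i) (blockVec p C n) := by
      rw [pow_blockVec_of_lt hp hC hi, inv_smul_smul₀ (lam_ne_zero C n i)]
    rw [h, map_smul, ← pow_add_apply, add_comm, pow_add_apply, pow_two_mul_blockLen_blockVec]
  | zero => exact ⟨1, one_pos, map_zero _⟩
  | add x y _ _ hx hy =>
    obtain ⟨P, hP, hx⟩ := hx
    obtain ⟨Q, hQ, hy⟩ := hy
    refine ⟨P * Q, Nat.mul_pos hP hQ, ?_⟩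
    rw [map_add, pow_apply_eq_of_dvd hx (dvd_mul_right _ _),
      pow_apply_eq_of_dvd hy (dvd_mul_left _ _)]
  | smul a x _ hx =>
    obtain ⟨P, hP, hx⟩ := hx
    exact ⟨P, hP, by rw [map_smul, hx]⟩

/-! ### Cancelling finitely supported vectors along a window of backward times -/

lemma norm_inv_coupling {n : ℕ} (hn : 1 ≤ n) :
    ‖(coupling C n)⁻¹‖ = 2 ^ tauParam C n.size := by
  rw [coupling, if_neg (by omega), inv_inv, norm_pow, Complex.norm_ofNat]

/-- A small vector at level `k` whose backward orbit, on a long window of times, cancels the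
vector `u` up to a small error. -/
def Absorbs (u : SeqSpace p) : Prop :=
  ∀ ε : ℝ, 0 < ε → ∃ k₀, ∀ k, k₀ ≤ k → ∃ z : SeqSpace p, ‖z‖ < ε ∧
    ∀ t, 3 * deltaParam C k + etaParam C k < t → t ≤ 2 * deltaParam C k + 2 * etaParam C k →
      ‖(inverseCLM hp hC ^ t) (z - u)‖ < ε

/-- The window depends on `k` only, so the cancelling vectors can be added. -/
lemma Absorbs.add {u u' : SeqSpace p} (h : Absorbs hp hC u) (h' : Absorbs hp hC u') :
    Absorbs hp hC (u + u') := by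
  intro ε hε
  obtain ⟨k₀, h⟩ := h (ε / 2) (by linarith)
  obtain ⟨k₁, h'⟩ := h' (ε / 2) (by linarith)
  refine ⟨max k₀ k₁, fun k hk => ?_⟩
  obtain ⟨z, hz, hzt⟩ := h k (le_trans (le_max_left _ _) hk)
  obtain ⟨z', hz', hzt'⟩ := h' k (le_trans (le_max_right _ _) hk)
  refine ⟨z + z', (norm_add_le _ _).trans_lt (by linarith), fun t h1 h2 => ?_⟩
  rw [add_sub_add_comm, map_add]
  exact (norm_add_le _ _).trans_lt (by linarith [hzt t h1 h2, hzt' t h1 h2])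

lemma Absorbs.smul {u : SeqSpace p} (h : Absorbs hp hC u) (a : ℂ) : Absorbs hp hC (a • u) := by
  intro ε hε
  have ha : 0 < ‖a‖ + 1 := by positivity
  obtain ⟨k₀, h⟩ := h (ε / (‖a‖ + 1)) (by positivity)
  have key : ∀ y : SeqSpace p, ‖y‖ < ε / (‖a‖ + 1) → ‖a • y‖ < ε := by
    intro y hy
    rw [lt_div_iff₀ ha] at hy
    rw [norm_smul]
    nlinarith [norm_nonneg y]
  refine ⟨k₀, fun k hk => ?_⟩
  obtain ⟨z, hz, hzt⟩ := h k hk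
  refine ⟨a • z, key z hz, fun t h1 h2 => ?_⟩
  rw [← smul_sub, map_smul]
  exact key _ (hzt t h1 h2)

/-- One turn of a child block deposits a multiple of the block vector of `m`; dividing by the
coupling constant costs `2 ^ τ`, which depth about δ = 2τ more than repays. -/
lemma absorbs_pow_blockVec {m i : ℕ} :
    Absorbs hp hC ((exampleCLM hp hC ^ i) (blockVec p C m)) := by
  intro ε hε
  obtain ⟨k₁, hk₁⟩ := exists_pow_lt_of_lt_one (y := (1 / 2 : ℝ)) (x := ε / 2 ^ i)
    (by positivity) (by norm_num)
  -- `k₁` gives smallness, `i` keeps δ + i inside the dip, `m` gives `m < 2 ^ (k - 1)`, and the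
  -- bracket is the exponent of 2 in `2 * blockLen C m`, for the divisibility `hdvd`.
  refine ⟨k₁ + i + m + 1 + (2 * C * m.size ^ 2 + m.size + 5), fun k hk => ?_⟩
  have hmk : m < 2 ^ (k - 1) :=
    Nat.lt_two_pow_self.trans_le (Nat.pow_le_pow_right (by norm_num) (by omega))
  have hτ : k < tauParam C k := lt_tauParam hC
  have hδτ := deltaParam_eq_two_mul_tauParam C k
  set n := m + 2 ^ (k - 1) with hn
  have hn1 : 1 ≤ n := by have : 0 < 2 ^ (k - 1) := by positivity
                         omega
  have hsize : n.size = k := by rw [hn, size_add_two_pow hmk]; omega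
  have hpar : parent n = m := parent_add_two_pow hmk
  have hlen : blockLen C n = blockParam C k := by rw [blockLen, hsize]
  have hΔ := four_delta_add_two_eta_lt C k
  rw [← hlen] at hΔ
  have hδη := deltaParam_le_etaParam C k
  have hη := etaParam_pos C k
  have hdvd : 2 * blockLen C m ∣ deltaParam C k := by
    unfold blockLen blockParam deltaParam
    rw [← pow_succ']
    apply pow_dvd_pow
    have := le_mul_sq (k := k) hC
    omega
  have hsmall : (2 : ℝ) ^ tauParam C k * (1 / 2) ^ (deltaParam C k - i) < ε := by
    have h1 : (2 : ℝ) ^ tauParam C k * (1 / 2) ^ (deltaParam C k - i) =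
        2 ^ i * (1 / 2) ^ tauParam C k := by
      have h3 : (1 / 2 : ℝ) ^ (deltaParam C k - i) * (1 / 2) ^ i =
          (1 / 2) ^ tauParam C k * (1 / 2) ^ tauParam C k := by
        rw [← pow_add, ← pow_add]; congr 1; omega
      have h4 : ∀ j : ℕ, (2 : ℝ) ^ j * (1 / 2) ^ j = 1 := fun j => by
        rw [← mul_pow]; norm_num
      calc (2 : ℝ) ^ tauParam C k * (1 / 2) ^ (deltaParam C k - i)
          = 2 ^ tauParam C k * ((1 / 2) ^ (deltaParam C k - i) * (1 / 2) ^ i) * 2 ^ i := by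
            linear_combination (-(2 : ℝ) ^ tauParam C k * (1 / 2) ^ (deltaParam C k - i)) * h4 i
        _ = _ := by rw [h3]; linear_combination 2 ^ i * (1 / 2) ^ tauParam C k * h4 (tauParam C k)
    have h2 : (1 / 2 : ℝ) ^ tauParam C k ≤ (1 / 2) ^ k₁ :=
      pow_le_pow_of_le_one (by norm_num) (by norm_num) (by omega)
    rw [h1]
    calc (2 : ℝ) ^ i * (1 / 2) ^ tauParam C k ≤ 2 ^ i * (1 / 2) ^ k₁ := by gcongr
      _ < 2 ^ i * (ε / 2 ^ i) := by gcongr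
      _ = ε := by field_simp
  -- The position δ + i is on the way out of the dip, at depth δ − i.
  refine ⟨(coupling C n)⁻¹ • (exampleCLM hp hC ^ (deltaParam C k + i)) (blockVec p C n), ?_, ?_⟩
  · rw [pow_blockVec_of_lt hp hC (by omega), norm_smul, norm_smul, norm_basisVec, mul_one,
      norm_inv_coupling hn1, norm_lam, hsize]
    have : depth (deltaParam C k) (etaParam C k) (blockLen C n) (deltaParam C k + i) =
        deltaParam C k - i := by
      unfold depth; split_ifs <;> omega
    rwa [this]
  · intro t ht1 ht2
    -- One further turn of block `n` produces `u`, because `hdvd` makes S^δ fix the block vector of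
    -- `m`.
    have hz : (coupling C n)⁻¹ • (exampleCLM hp hC ^ (deltaParam C k + i)) (blockVec p C n) -
        (exampleCLM hp hC ^ i) (blockVec p C m) = -((coupling C n)⁻¹ •
          (exampleCLM hp hC ^ (t + (blockLen C n + deltaParam C k + i - t))) (blockVec p C n)) := by
      have e1 : t + (blockLen C n + deltaParam C k + i - t) =
          (deltaParam C k + i) + blockLen C n := by omega
      have e2 : (exampleCLM hp hC ^ (deltaParam C k + i)) (blockVec p C m) =
          (exampleCLM hp hC ^ i) (blockVec p C m) := by
        rw [add_comm, pow_add_apply,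
          pow_apply_eq_of_dvd (pow_two_mul_blockLen_blockVec hp hC m) hdvd]
      rw [e1, pow_add_apply _ (deltaParam C k + i) (blockLen C n), pow_blockLen_blockVec, hpar, map_sub, map_smul, e2, smul_sub,
        inv_smul_smul₀ (coupling_ne_zero hn1)]
      abel
    rw [hz, map_neg, norm_neg, map_smul, inverseCLM_pow_exampleCLM_pow,
      pow_blockVec_of_lt hp hC (by omega), norm_smul, norm_smul, norm_basisVec, mul_one,
      norm_inv_coupling hn1, norm_lam, hsize]
    -- For `t` in the window the position Δ + δ + i − t stays on the plateau, as 0 ≤ i ≤ δ.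
    have : depth (deltaParam C k) (etaParam C k) (blockLen C n)
        (blockLen C n + deltaParam C k + i - t) = deltaParam C k := by
      unfold depth; split_ifs <;> omega
    rw [this]
    refine lt_of_le_of_lt ?_ hsmall
    gcongr 2 ^ tauParam C k * ?_
    exact pow_le_pow_of_le_one (by norm_num) (by norm_num) (by omega)

lemma absorbs_of_mem_span {u : SeqSpace p}
    (hu : u ∈ Submodule.span ℂ (Set.range (basisVec p))) : Absorbs hp hC u := by
  induction hu using Submodule.span_induction with
  | mem x hx =>
    obtain ⟨κ, rfl⟩ := hx
    obtain ⟨n, i, hi, rfl⟩ := exists_block C κ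
    have h : basisVec p (blockStart C n + i) =
        (lam C n i)⁻¹ • (exampleCLM hp hC ^ i) (blockVec p C n) := by
      rw [pow_blockVec_of_lt hp hC hi, inv_smul_smul₀ (lam_ne_zero C n i)]
    rw [h]
    exact (absorbs_pow_blockVec hp hC).smul hp hC _
  | zero => exact fun ε hε => ⟨0, fun k _ => ⟨0, by simpa using hε, fun t _ _ => by simpa using hε⟩⟩
  | add x y _ _ hx hy => exact hx.add hp hC hy
  | smul a x _ hx => exact hx.smul hp hC a

/-- The number of multiples of `P` in the interval `(a, b]`. -/
lemma le_ncard_multiples {A : Set ℕ} {P a b : ℕ} (hP : 0 < P)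
    (h : ∀ t, P ∣ t → a < t → t ≤ b → t ∈ A) : b / P ≤ (A ∩ Set.Iic b).ncard + a / P := by
  have hsub : ((Finset.Ioc (a / P) (b / P)).image (P * ·) : Set ℕ) ⊆ A ∩ Set.Iic b := by
    intro t ht
    simp only [Finset.coe_image, Finset.coe_Ioc, Set.mem_image, Set.mem_Ioc] at ht
    obtain ⟨q, ⟨h1, h2⟩, rfl⟩ := ht
    have h3 : P * q ≤ b := by rw [mul_comm]; exact (Nat.le_div_iff_mul_le hP).1 h2
    have h4 : a < P * q := by rw [mul_comm]; exact (Nat.div_lt_iff_lt_mul hP).1 h1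
    exact ⟨h _ (dvd_mul_right _ _) h4 h3, h3⟩
  have h1 := Set.ncard_le_ncard hsub ((Set.finite_Iic b).inter_of_right _)
  rw [Set.ncard_coe_finset, Finset.card_image_of_injective _ (mul_right_injective₀ hP.ne'),
    Nat.card_Ioc] at h1
  omega

/-- The window has length η − δ and its right end is about 2η, so the multiples of `P` in it have
proportion near 1/(2P); 32 leaves ample room. -/
lemma window_density {A : Set ℕ} {P k : ℕ} (hC : 10 ≤ C) (hP : 0 < P) (hk : 1 ≤ k) (hPk : 4 * P ≤ k)
    (h : ∀ t, P ∣ t → 3 * deltaParam C k + etaParam C k < t →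
      t ≤ 2 * deltaParam C k + 2 * etaParam C k → t ∈ A) :
    1 / (32 * (P : ℝ)) <
      ((A ∩ Set.Iic (2 * deltaParam C k + 2 * etaParam C k)).ncard : ℝ) /
        (((2 * deltaParam C k + 2 * etaParam C k : ℕ) : ℝ) + 1) := by
  have h1 := le_ncard_multiples hP h
  have h2 := two_pow_mul_deltaParam_le hC hk
  have h3 : k < etaParam C k := (lt_tauParam hC).trans_le
    ((by rw [deltaParam_eq_two_mul_tauParam]; omega : tauParam C k ≤ deltaParam C k).trans
      (deltaParam_le_etaParam C k))
  have h4 : 2 * (2 * deltaParam C k) ≤ etaParam C k := le_trans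
    (Nat.mul_le_mul_right _ (by calc 2 = 2 ^ 1 := rfl
                                  _ ≤ 2 ^ k := Nat.pow_le_pow_right (by norm_num) hk)) h2
  generalize deltaParam C k = δ at *
  generalize etaParam C k = η at *
  generalize (A ∩ Set.Iic (2 * δ + 2 * η)).ncard = c at *
  have hb : 2 * δ + 2 * η < P * ((2 * δ + 2 * η) / P) + P := Nat.lt_mul_div_succ _ hP
  have ha : P * ((3 * δ + η) / P) ≤ 3 * δ + η := Nat.mul_div_le _ _
  have hc : P * ((2 * δ + 2 * η) / P) ≤ P * c + P * ((3 * δ + η) / P) := by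
    exact (Nat.mul_le_mul_left P h1).trans_eq (mul_add _ _ _)
  have hmain : η < P * c + P + δ := by omega
  have hP' : (0 : ℝ) < P := by exact_mod_cast hP
  rw [div_lt_div_iff₀ (by positivity) (by positivity)]
  have : 2 * δ + 2 * η + 1 < c * (32 * P) := by
    have : c * (32 * P) = 32 * (P * c) := by ring
    omega
  rw [one_mul]
  exact_mod_cast this

lemma isUFrequentlyHypercyclic_inverseCLM : IsUFrequentlyHypercyclic (inverseCLM (p := p) hp hC) := by
  have := secondCountableTopology_seqSpace hp
  have hdense := dense_span_basisVec hp
  refine isUFrequentlyHypercyclic_of_dense _ fun V hV hVne => ?_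
  obtain ⟨y, hyV, hy⟩ := hdense.inter_open_nonempty V hV hVne
  obtain ⟨P, hP, hPy⟩ := exists_period hp hC hy
  obtain ⟨ε, hε, hball⟩ := Metric.isOpen_iff.1 hV y hyV
  -- `P` comes from `V` alone, as the criterion requires.
  refine ⟨1 / (32 * P), by positivity, fun U hU hUne N₀ => ?_⟩
  obtain ⟨x₀, hxU, hx₀⟩ := hdense.inter_open_nonempty U hU hUne
  obtain ⟨ε', hε', hball'⟩ := Metric.isOpen_iff.1 hU x₀ hxU
  obtain ⟨k₀, hk₀⟩ := absorbs_of_mem_span hp hC (Submodule.sub_mem _ hy hx₀)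
    (min ε ε') (lt_min hε hε')
  obtain ⟨z, hz, hzt⟩ := hk₀ (k₀ + N₀ + 4 * P + 1) (by omega)
  set k := k₀ + N₀ + 4 * P + 1 with hk
  refine ⟨x₀ + z, hball' ?_, 2 * deltaParam C k + 2 * etaParam C k, ?_,
    window_density hC hP (by omega) (by omega) ?_⟩
  · rw [Metric.mem_ball, dist_eq_norm, add_sub_cancel_left]
    exact hz.trans_le (min_le_right _ _)
  · have h1 : k < tauParam C k := lt_tauParam hC
    have h2 := deltaParam_eq_two_mul_tauParam C k
    omega
  · intro t hPt h1 h2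
    refine hball ?_
    have e : x₀ + z = (z - (y - x₀)) + y := by abel
    rw [Metric.mem_ball, dist_eq_norm, e, map_add, inverseCLM_pow_of_periodic hp hC hPy hPt,
      add_sub_cancel_right]
    exact (hzt t h1 h2).trans_le (min_le_left _ _)

end Inverse

/-! ### Coordinates of the orbits of the block vectors -/

lemma smul_basisVec_apply_ne {p : ℝ≥0∞} {a : ℂ} {κ κ' : ℕ} (h : κ' ≠ κ) : (a • basisVec p κ) κ' = 0 := by
  rw [lp.coeFn_smul, Pi.smul_apply, basisVec_apply, if_neg h, smul_zero]

lemma smul_basisVec_apply_self {p : ℝ≥0∞} (a : ℂ) (κ : ℕ) : (a • basisVec p κ) κ = a := by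
  rw [lp.coeFn_smul, Pi.smul_apply, basisVec_apply, if_pos rfl, smul_eq_mul, mul_one]

section Coordinates

variable {p : ℝ≥0∞} [Fact (1 ≤ p)] (hp : p ≠ ⊤) {C : ℕ} (hC : 10 ≤ C)

lemma norm_coupling_le_half (hC : 10 ≤ C) (n : ℕ) : ‖coupling C n‖ ≤ 1 / 2 := by
  have h1 := norm_coupling_le hC n
  have h2 : (1 / 2 : ℝ) ^ n ≤ 1 := pow_le_one₀ (by norm_num) (by norm_num)
  linarith

lemma norm_lam_smul_basisVec_le (n i κ : ℕ) : ‖lam C n i • basisVec p κ‖ ≤ 1 := by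
  rw [norm_smul, norm_basisVec, mul_one]
  exact norm_lam_le_one C n i

/-- Coupling constants are at most 1/2, and 1 + (1/2)·2 = 2 closes the induction along parents. -/
lemma norm_pow_blockVec_le (n r : ℕ) : ‖(exampleCLM hp hC ^ r) (blockVec p C n)‖ ≤ 2 := by
  induction n using Nat.strong_induction_on generalizing r with
  | _ n ih =>
    rw [pow_blockVec]
    split_ifs
    · exact (norm_lam_smul_basisVec_le _ _ _).trans (by norm_num)
    · refine (norm_sub_le _ _).trans ?_
      have h1 := norm_lam_smul_basisVec_le (p := p) (C := C) n (r % blockLen C n)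
        (blockStart C n + r % blockLen C n)
      rcases Nat.eq_zero_or_pos n with rfl | hn
      · rw [coupling, if_pos rfl, zero_smul, norm_zero]; linarith
      · have h2 := ih _ (parent_lt hn) (r % blockLen C n)
        have h3 := norm_coupling_le_half hC n
        rw [norm_smul]
        nlinarith [norm_nonneg (coupling C n)]

/-- Coupling only goes down to parents, so an orbit never enters a higher block. -/
lemma pow_blockVec_apply_of_lt {m n j : ℕ} (r : ℕ) (hj : j < blockLen C m) (hnm : n < m) :
    (exampleCLM hp hC ^ r) (blockVec p C n) (blockStart C m + j) = 0 := by
  induction n using Nat.strong_induction_on generalizing r with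
  | _ n ih =>
    have hne : blockStart C m + j ≠ blockStart C n + r % blockLen C n := fun h =>
      hnm.ne' (block_unique hj (Nat.mod_lt _ (blockLen_pos C n)) h).1
    rw [pow_blockVec]
    split_ifs
    · exact smul_basisVec_apply_ne hne
    · rw [lp.coeFn_sub, Pi.sub_apply, smul_basisVec_apply_ne hne, sub_zero, lp.coeFn_smul,
        Pi.smul_apply]
      rcases Nat.eq_zero_or_pos n with rfl | hn
      · rw [coupling, if_pos rfl, zero_smul]
      · rw [ih _ (parent_lt hn) _ ((parent_lt hn).trans hnm), smul_zero]

lemma pow_blockVec_apply_eq_zero {m n j r : ℕ} (hj : j < blockLen C m) (hnm : m ≠ n)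
    (hr : r < blockLen C n) :
    (exampleCLM hp hC ^ r) (blockVec p C n) (blockStart C m + j) = 0 := by
  rw [pow_blockVec_of_lt hp hC hr]
  exact smul_basisVec_apply_ne fun h => hnm (block_unique hj hr h).1

/-- Whatever leaves block `n` passes through its coupling constant once. -/
lemma norm_pow_blockVec_apply_le {m n j : ℕ} (r : ℕ) (hj : j < blockLen C m) (hnm : m ≠ n) :
    ‖(exampleCLM hp hC ^ r) (blockVec p C n) (blockStart C m + j)‖ ≤ 2 * ‖coupling C n‖ := by
  have hne : blockStart C m + j ≠ blockStart C n + r % blockLen C n := fun h =>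
    hnm (block_unique hj (Nat.mod_lt _ (blockLen_pos C n)) h).1
  rw [pow_blockVec]
  split_ifs
  · rw [smul_basisVec_apply_ne hne, norm_zero]; positivity
  · rw [lp.coeFn_sub, Pi.sub_apply, smul_basisVec_apply_ne hne, sub_zero, lp.coeFn_smul,
      Pi.smul_apply, norm_smul, mul_comm]
    gcongr
    exact (norm_coord_le _ _).trans (norm_pow_blockVec_le hp hC _ _)

lemma pow_blockVec_apply_own {n j : ℕ} (r : ℕ) (hj : j < blockLen C n) :
    ‖(exampleCLM hp hC ^ r) (blockVec p C n) (blockStart C n + j)‖ =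
      if j = r % blockLen C n then ‖lam C n j‖ else 0 := by
  have hcoup : (coupling C n • (exampleCLM hp hC ^ (r % blockLen C n)) (blockVec p C (parent n)))
      (blockStart C n + j) = 0 := by
    rw [lp.coeFn_smul, Pi.smul_apply]
    rcases Nat.eq_zero_or_pos n with rfl | hn
    · rw [coupling, if_pos rfl, zero_smul]
    · rw [pow_blockVec_apply_of_lt hp hC _ hj (parent_lt hn), smul_zero]
  have hnorm : ‖(exampleCLM hp hC ^ r) (blockVec p C n) (blockStart C n + j)‖ =
      ‖(lam C n (r % blockLen C n) • basisVec p (blockStart C n + r % blockLen C n))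
        (blockStart C n + j)‖ := by
    rw [pow_blockVec]
    split_ifs
    · rfl
    · rw [lp.coeFn_sub, Pi.sub_apply, hcoup, zero_sub, norm_neg]
  rw [hnorm]
  split_ifs with h
  · rw [← h, smul_basisVec_apply_self]
  · rw [smul_basisVec_apply_ne (by omega), norm_zero]

/-! ### Expansion of the orbit of a general vector -/

/-- The coefficient of `x` at index `κ` with respect to the orbit of the block vectors. -/
def orbitCoeff (C : ℕ) (x : SeqSpace p) (κ : ℕ) : ℂ :=
  x κ * (lam C (blockOf C κ) (posOf C κ))⁻¹

/-- Each term of the basis expansion of `x` is a multiple of a point on the orbit of a block vector,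
so applying the operator only shifts the time. -/
lemma hasSum_orbitCoeff (x : SeqSpace p) (t κ₀ : ℕ) :
    HasSum (fun κ => orbitCoeff C x κ *
      (exampleCLM hp hC ^ (posOf C κ + t)) (blockVec p C (blockOf C κ)) κ₀)
      ((exampleCLM hp hC ^ t) x κ₀) := by
  have h := (hasSum_basisVec hp x).mapL
    ((lp.evalCLM ℂ (fun _ : ℕ => ℂ) p κ₀).comp (exampleCLM hp hC ^ t))
  have key : ∀ κ, ((lp.evalCLM ℂ (fun _ : ℕ => ℂ) p κ₀).comp (exampleCLM hp hC ^ t))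
      (x κ • basisVec p κ) = orbitCoeff C x κ *
        (exampleCLM hp hC ^ (posOf C κ + t)) (blockVec p C (blockOf C κ)) κ₀ := by
    intro κ
    have hb : basisVec p κ = (lam C (blockOf C κ) (posOf C κ))⁻¹ •
        (exampleCLM hp hC ^ posOf C κ) (blockVec p C (blockOf C κ)) := by
      rw [pow_blockVec_of_lt hp hC (posOf_lt C κ), inv_smul_smul₀ (lam_ne_zero C _ _),
        blockStart_add_posOf]
    rw [hb, smul_smul, map_smul, smul_eq_mul, add_comm, ContinuousLinearMap.comp_apply,
      ← pow_add_apply]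
    rfl
  simp only [key] at h
  exact h

/-- A summable majorant for the contributions of higher blocks. -/
def couplingMajorant (C κ : ℕ) : ℝ := 2 * ‖coupling C (blockOf C κ)‖

lemma couplingMajorant_nonneg (C κ : ℕ) : 0 ≤ couplingMajorant C κ := by
  unfold couplingMajorant; positivity

lemma sum_range_couplingMajorant_le (hC : 10 ≤ C) (N : ℕ) :
    ∑ κ ∈ Finset.range N, couplingMajorant C κ ≤ 1 / 2 := by
  have hblock : ∀ N, ∑ κ ∈ Finset.range (blockStart C N), couplingMajorant C κ =
      ∑ n ∈ Finset.range N, blockLen C n * (2 * ‖coupling C n‖) := by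
    intro N
    induction N with
    | zero => simp [blockStart_zero]
    | succ N ih =>
      rw [blockStart_succ, Finset.sum_range_add, ih, Finset.sum_range_succ]
      congr 1
      rw [Finset.sum_congr rfl fun i hi => by
        rw [couplingMajorant, blockOf_add (Finset.mem_range.1 hi)]]
      rw [Finset.sum_const, Finset.card_range, nsmul_eq_mul]
  calc ∑ κ ∈ Finset.range N, couplingMajorant C κ
      ≤ ∑ κ ∈ Finset.range (blockStart C N), couplingMajorant C κ :=
        Finset.sum_le_sum_of_subset_of_nonneg
          (Finset.range_mono (blockStart_strictMono C).le_apply)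
          fun κ _ _ => couplingMajorant_nonneg C κ
    _ = ∑ n ∈ Finset.range N, blockLen C n * (2 * ‖coupling C n‖) := hblock N
    _ ≤ ∑ n ∈ Finset.range N, 1 / 4 * (1 / 2 : ℝ) ^ n := by
        refine Finset.sum_le_sum fun n _ => ?_
        have := norm_coupling_mul_le hC n
        linarith
    _ = 1 / 4 * ∑ n ∈ Finset.range N, (1 / 2 : ℝ) ^ n := by rw [Finset.mul_sum]
    _ ≤ 1 / 4 * 2 := by
        gcongr
        exact sum_geometric_two_le N
    _ = 1 / 2 := by norm_num

lemma summable_couplingMajorant (hC : 10 ≤ C) : Summable (couplingMajorant C) :=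
  summable_of_sum_range_le (couplingMajorant_nonneg C) (sum_range_couplingMajorant_le hC)

lemma tsum_couplingMajorant_le (hC : 10 ≤ C) : ∑' κ, couplingMajorant C κ ≤ 1 / 2 :=
  Real.tsum_le_of_sum_range_le (couplingMajorant_nonneg C) (sum_range_couplingMajorant_le hC)

/-- If no higher block has contributed significantly up to time `t`, the contribution of a single
coordinate can be read off from the orbit. -/
lemma norm_orbit_apply_ge (x : SeqSpace p) {n i t : ℕ} (hi : i < blockLen C n)
    (hx : ∀ κ, n < blockOf C κ → blockLen C (blockOf C κ) ≤ posOf C κ + t →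
      ‖orbitCoeff C x κ‖ ≤ 1) :
    ‖orbitCoeff C x (blockStart C n + i)‖ * ‖lam C n ((i + t) % blockLen C n)‖ - 1 / 2 ≤
      ‖(exampleCLM hp hC ^ t) x (blockStart C n + (i + t) % blockLen C n)‖ := by
  have hj : (i + t) % blockLen C n < blockLen C n := Nat.mod_lt _ (blockLen_pos C n)
  have hsum := hasSum_orbitCoeff hp hC x t (blockStart C n + (i + t) % blockLen C n)
  have hrest := hasSum_ite_sub_hasSum hsum (blockStart C n + i)
  have hbound := tsum_of_norm_bounded (summable_couplingMajorant hC).hasSum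
    (f := fun κ => if κ = blockStart C n + i then 0 else orbitCoeff C x κ *
      (exampleCLM hp hC ^ (posOf C κ + t)) (blockVec p C (blockOf C κ))
        (blockStart C n + (i + t) % blockLen C n)) ?_
  · rw [hrest.tsum_eq, blockOf_add hi, posOf_add hi] at hbound
    have hown := pow_blockVec_apply_own (p := p) hp hC (i + t) hj
    rw [if_pos rfl] at hown
    have h1 := hbound.trans (tsum_couplingMajorant_le hC)
    have h2 := norm_sub_norm_le (orbitCoeff C x (blockStart C n + i) *
      (exampleCLM hp hC ^ (i + t)) (blockVec p C n) (blockStart C n + (i + t) % blockLen C n))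
      ((exampleCLM hp hC ^ t) x (blockStart C n + (i + t) % blockLen C n))
    rw [norm_sub_rev, norm_mul, hown] at h2
    linarith
  · intro κ
    split_ifs with hκ
    · rw [norm_zero]; exact couplingMajorant_nonneg C κ
    rw [norm_mul]
    have hle : ∀ a : ℝ, a = 0 → ‖orbitCoeff C x κ‖ * a ≤ couplingMajorant C κ := by
      rintro a rfl
      rw [mul_zero]; exact couplingMajorant_nonneg C κ
    rcases lt_trichotomy (blockOf C κ) n with h | h | h
    · exact hle _ (by rw [pow_blockVec_apply_of_lt hp hC _ hj h, norm_zero])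
    · refine hle _ ?_
      subst h
      rw [pow_blockVec_apply_own hp hC _ hj, if_neg]
      intro h'
      -- Distinct positions of one block stay distinct under rotation.
      have h1 : i ≡ posOf C κ [MOD blockLen C (blockOf C κ)] := Nat.ModEq.add_right_cancel' t h'
      have h2 := Nat.ModEq.eq_of_lt_of_lt h1 hi (posOf_lt C κ)
      exact hκ (by rw [h2, blockStart_add_posOf])
    -- A higher block contributes nothing before its first turn ends; afterwards `hx` bounds its
    -- coefficient by 1 and the majorant applies.
    · by_cases hr : posOf C κ + t < blockLen C (blockOf C κ)
      · exact hle _ (by rw [pow_blockVec_apply_eq_zero hp hC hj h.ne hr, norm_zero])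
      · have h1 := hx κ h (not_lt.1 hr)
        have h2 := norm_pow_blockVec_apply_le (p := p) hp hC (posOf C κ + t) hj h.ne
        calc _ ≤ 1 * (2 * ‖coupling C (blockOf C κ)‖) :=
              mul_le_mul h1 h2 (norm_nonneg _) zero_le_one
          _ = _ := one_mul _

/-- If the coefficients outside finitely many blocks are bounded by `1`, the first coordinate of
the orbit is bounded. -/
lemma exists_bound_orbit_apply_zero (x : SeqSpace p) {M : ℕ} (hM : 1 ≤ M)
    (hx : ∀ κ, M ≤ blockOf C κ → ‖orbitCoeff C x κ‖ ≤ 1) :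
    ∃ R : ℝ, ∀ t, ‖(exampleCLM hp hC ^ t) x 0‖ ≤ R := by
  have hfin : HasSum (fun κ => if κ ∈ Finset.range (blockStart C M) then
      2 * ‖orbitCoeff C x κ‖ else 0) _ :=
    hasSum_sum_of_ne_finset_zero (s := Finset.range (blockStart C M)) fun κ hκ => if_neg hκ
  obtain ⟨R, hmaj⟩ : ∃ R, HasSum (fun κ => couplingMajorant C κ +
      if κ ∈ Finset.range (blockStart C M) then 2 * ‖orbitCoeff C x κ‖ else 0) R :=
    ⟨_, (summable_couplingMajorant hC).hasSum.add hfin⟩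
  refine ⟨R, fun t => ?_⟩
  rw [← (hasSum_orbitCoeff hp hC x t 0).tsum_eq]
  refine tsum_of_norm_bounded hmaj fun κ => ?_
  have h0 := couplingMajorant_nonneg C κ
  rw [norm_mul]
  by_cases hκ : M ≤ blockOf C κ
  · have h1 := hx κ hκ
    have h2 := norm_pow_blockVec_apply_le (p := p) hp hC (posOf C κ + t) (blockLen_pos C 0)
      (show 0 ≠ blockOf C κ by omega)
    rw [blockStart_zero, add_zero] at h2
    have h3 : ‖orbitCoeff C x κ‖ *
        ‖(exampleCLM hp hC ^ (posOf C κ + t)) (blockVec p C (blockOf C κ)) 0‖ ≤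
        1 * (2 * ‖coupling C (blockOf C κ)‖) := mul_le_mul h1 h2 (norm_nonneg _) zero_le_one
    have h4 : couplingMajorant C κ = 2 * ‖coupling C (blockOf C κ)‖ := rfl
    split_ifs
    · linarith [norm_nonneg (orbitCoeff C x κ)]
    · linarith
  · have hlt : κ < blockStart C M := by
      have h1 := posOf_lt C κ
      have h2 := blockStart_add_posOf C κ
      have h3 := (blockStart_strictMono C).monotone (show blockOf C κ + 1 ≤ M by omega)
      rw [blockStart_succ] at h3
      omega
    rw [if_pos (Finset.mem_range.2 hlt)]
    have h1 := (norm_coord_le ((exampleCLM hp hC ^ (posOf C κ + t))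
      (blockVec p C (blockOf C κ))) 0).trans (norm_pow_blockVec_le hp hC _ _)
    nlinarith [norm_nonneg (orbitCoeff C x κ)]

end Coordinates

/-! ### Counting -/

lemma card_filter_range_le (G : ℕ → Prop) [DecidablePred G] {a u d e N : ℕ}
    (h1 : ∀ t, a ≤ t → t < u → t < N → ¬ G t)
    (h2 : ∀ t, u ≤ t → t < N → u + d ≤ t → t < u + e → ¬ G t) :
    ((Finset.range N).filter G).card ≤
      ((Finset.range a).filter G).card + d + (N - (u + e)) := by
  have hsub : (Finset.range N).filter G ⊆
      ((Finset.range a).filter G ∪ Finset.Ico u (u + d)) ∪ Finset.Ico (u + e) N := by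
    intro t ht
    rw [Finset.mem_filter, Finset.mem_range] at ht
    simp only [Finset.mem_union, Finset.mem_filter, Finset.mem_range, Finset.mem_Ico]
    by_cases hta : t < a
    · exact Or.inl (Or.inl ⟨hta, ht.2⟩)
    by_cases htu : t < u
    · exact absurd ht.2 (h1 t (by omega) htu ht.1)
    by_cases htd : t < u + d
    · exact Or.inl (Or.inr ⟨by omega, htd⟩)
    by_cases hte : t < u + e
    · exact absurd ht.2 (h2 t (by omega) ht.1 (by omega) hte)
    · exact Or.inr ⟨by omega, ht.1⟩
  have h3 := Finset.card_le_card hsub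
  have h4 := Finset.card_union_le ((Finset.range a).filter G ∪ Finset.Ico u (u + d))
    (Finset.Ico (u + e) N)
  have h5 := Finset.card_union_le ((Finset.range a).filter G) (Finset.Ico u (u + d))
  rw [Nat.card_Ico] at h4 h5
  omega

lemma depth_eq_zero {δ η Δ i : ℕ} (h : 4 * δ + 2 * η < Δ)
    (hi : (2 * δ ≤ i ∧ i < Δ - 2 * δ - 2 * η) ∨ Δ - η ≤ i) : depth δ η Δ i = 0 := by
  unfold depth; split_ifs <;> omega

lemma norm_lam_eq_one {C n i : ℕ}
    (hi : (2 * deltaParam C n.size ≤ i ∧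
        i < blockLen C n - 2 * deltaParam C n.size - 2 * etaParam C n.size) ∨
      blockLen C n - etaParam C n.size ≤ i) : ‖lam C n i‖ = 1 := by
  rw [norm_lam, depth_eq_zero (Δ := blockLen C n) (four_delta_add_two_eta_lt C n.size) hi, pow_zero]

/-- Makes the search for the highest active block finite in `two_pow_mul_card_le`. -/
lemma lt_etaParam_size {C : ℕ} (hC : 10 ≤ C) (n : ℕ) : n < etaParam C n.size := by
  refine (Nat.lt_size_self n).trans_le (Nat.pow_le_pow_right (by norm_num) ?_)
  have := le_mul_sq (k := n.size) hC
  rw [mul_assoc]; omega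

/-- The η visit-free times before `u` pay for the dip of length 2δ; if `N` goes beyond the long
visit-free stretch, its length of order Δ pays for the remaining 2δ + 2η times. -/
lemma count_step_arith {E c δ η Δ u N x y : ℕ} (hE : 1 ≤ E) (hδ : E * (2 * δ) ≤ η)
    (hΔ : 8 * (E * η) ≤ Δ) (hηu : η ≤ u) (huN : u ≤ N) (hN : N ≤ u + Δ)
    (hx : E * x ≤ (u - η) + E * c)
    (hy : y ≤ x + 2 * δ + (N - (u + (Δ - 2 * δ - 2 * η)))) : E * y ≤ N + E * c := by
  have h1 := Nat.mul_le_mul_left E hy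
  rw [mul_add, mul_add] at h1
  have h2 : 1 * η ≤ E * η := Nat.mul_le_mul_right _ hE
  have h3 : 1 * (2 * δ) ≤ E * (2 * δ) := Nat.mul_le_mul_right _ hE
  by_cases h : N ≤ u + (Δ - 2 * δ - 2 * η)
  · rw [Nat.sub_eq_zero_of_le h, mul_zero] at h1
    omega
  · have h4 : E * (N - (u + (Δ - 2 * δ - 2 * η))) ≤ E * (2 * δ + 2 * η) :=
      Nat.mul_le_mul_left _ (by omega)
    have h5 : E * (2 * δ + 2 * η) = E * (2 * δ) + 2 * (E * η) := by ring
    omega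

/-! ### The operator is not `𝒰`-frequently hypercyclic -/

section NotUFHC

variable {p : ℝ≥0∞} [Fact (1 ≤ p)] (hp : p ≠ ⊤) {C : ℕ} (hC : 10 ≤ C)

lemma upperDensity_empty : upperDensity ∅ ≤ 0 :=
  upperDensity_le (d := 0) fun N => by simp

/-- Otherwise coordinate 0 of the orbit is bounded, and the orbit misses the open set where that
coordinate is larger. -/
lemma exists_orbitCoeff_gt (x : SeqSpace p)
    (hx : ∀ U : Set (SeqSpace p), IsOpen U → U.Nonempty →
      0 < upperDensity (returnSet (exampleCLM hp hC) x U)) {M : ℕ} (hM : 1 ≤ M) :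
    ∃ κ, M ≤ blockOf C κ ∧ 1 < ‖orbitCoeff C x κ‖ := by
  by_contra! hcon
  obtain ⟨R, hR⟩ := exists_bound_orbit_apply_zero hp hC x hM hcon
  have hR0 : 0 ≤ R := (norm_nonneg _).trans (hR 0)
  let U : Set (SeqSpace p) := {y | R < ‖y 0‖}
  have hU : IsOpen U := isOpen_lt continuous_const
    (lp.evalCLM ℂ (fun _ : ℕ => ℂ) p 0).continuous.norm
  have hne : U.Nonempty := by
    refine ⟨((R + 1 : ℝ) : ℂ) • basisVec p 0, ?_⟩
    change R < ‖_‖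
    rw [smul_basisVec_apply_self, Complex.norm_real, Real.norm_of_nonneg (by linarith)]
    linarith
  have hempty : returnSet (exampleCLM hp hC) x U = ∅ :=
    Set.eq_empty_of_forall_notMem fun t ht => absurd (hR t) (not_le.2 ht)
  have := hx U hU hne
  rw [hempty] at this
  exact absurd upperDensity_empty (not_le.2 this)

lemma exists_forall_norm_coord_lt_one (hp : p ≠ ⊤) (x : SeqSpace p) :
    ∃ M₀, ∀ κ, M₀ ≤ κ → ‖x κ‖ < 1 := by
  have h := (hasSum_basisVec hp x).summable.tendsto_atTop_zero
  have h1 := (Metric.tendsto_atTop.1 h) 1 one_pos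
  obtain ⟨M₀, h1⟩ := h1
  refine ⟨M₀, fun κ hκ => ?_⟩
  have := h1 κ hκ
  rwa [dist_zero_right, norm_smul, norm_basisVec, mul_one] at this

/-- Once some coefficient at a high level is significant, the orbit is rarely in the ball of
radius `1/2`. -/
lemma two_pow_mul_card_le (x : SeqSpace p) {K M κ₁ : ℕ} (hKM : 2 ^ K ≤ M)
    (hM : ∀ κ, M ≤ κ → ‖x κ‖ < 1) (hκ₁ : M ≤ blockOf C κ₁) (hκ₁' : 1 < ‖orbitCoeff C x κ₁‖)
    (G : ℕ → Prop) [DecidablePred G] (hG : ∀ t, G t → ‖(exampleCLM hp hC ^ t) x‖ < 1 / 2) (N : ℕ) :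
    2 ^ K * ((Finset.range N).filter G).card ≤ N + 2 ^ K * blockLen C (blockOf C κ₁) := by
  induction N using Nat.strong_induction_on with
  | _ N ih =>
  rcases le_or_gt N (blockLen C (blockOf C κ₁)) with hN | hN
  · have h1 := (Finset.card_filter_le (Finset.range N) G).trans_eq (Finset.card_range N)
    have := Nat.mul_le_mul_left (2 ^ K) (h1.trans hN)
    omega
  -- In the last η positions the coefficient has the modulus of a coordinate of `x`, which is below
  -- 1.
  have hpos : ∀ κ, M ≤ blockOf C κ → 1 < ‖orbitCoeff C x κ‖ →
      posOf C κ < blockLen C (blockOf C κ) - etaParam C (blockOf C κ).size := by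
    intro κ hκ hκ'
    by_contra hcon
    have h1 : ‖lam C (blockOf C κ) (posOf C κ)‖ = 1 := norm_lam_eq_one (Or.inr (not_lt.1 hcon))
    rw [orbitCoeff, norm_mul, norm_inv, h1, inv_one, mul_one] at hκ'
    have h2 : M ≤ κ := hκ.trans
      ((blockStart_strictMono C).le_apply.trans (blockStart_blockOf_le C κ))
    exact absurd (hM κ h2) (not_lt.2 hκ'.le)
  -- `P n`: some large coefficient in block `n` has completed its first turn before time `N`. The
  -- highest such block controls all times below `N`.
  let P : ℕ → Prop := fun n => ∃ κ, blockOf C κ = n ∧ M ≤ n ∧ 1 < ‖orbitCoeff C x κ‖ ∧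
    blockLen C n < posOf C κ + N
  have : DecidablePred P := Classical.decPred P
  have hPN : ∀ n, P n → n ≤ N := by
    rintro n ⟨κ, rfl, h1, h2, h3⟩
    have h4 := hpos κ h1 h2
    have h5 := lt_etaParam_size hC (blockOf C κ)
    omega
  have hP₁ : P (blockOf C κ₁) := ⟨κ₁, rfl, hκ₁, hκ₁', by omega⟩
  have hmax := Nat.findGreatest_spec (P := P) (hPN _ hP₁) hP₁
  have hgreat : ∀ n, Nat.findGreatest P N < n → ¬ P n := fun n hn hPn =>
    Nat.findGreatest_is_greatest hn (hPN n hPn) hPn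
  generalize Nat.findGreatest P N = n at hmax hgreat
  obtain ⟨κ, hκn, hMn, hκ, hκN⟩ := hmax
  have hi := posOf_lt C κ
  have hiη := hpos κ (hκn ▸ hMn) hκ
  have hκi := blockStart_add_posOf C κ
  rw [hκn] at hi hiη hκi
  generalize posOf C κ = i at *
  subst hκi
  have hbad : ∀ t, t < N → ‖lam C n ((i + t) % blockLen C n)‖ = 1 → ¬ G t := by
    intro t ht hlam hGt
    have h1 := norm_orbit_apply_ge hp hC x (t := t) hi (fun κ' h1 h2 => by
      by_contra hcon
      exact hgreat _ h1 ⟨κ', rfl, by omega, not_le.1 hcon, by omega⟩)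
    have h2 := norm_coord_le ((exampleCLM hp hC ^ t) x) (blockStart C n + (i + t) % blockLen C n)
    rw [hlam, mul_one] at h1
    have h3 := hG t hGt
    linarith
  have hΔ := four_delta_add_two_eta_lt C n.size
  change _ < blockLen C n at hΔ
  have hη := etaParam_pos C n.size
  have hKn : K < n.size := Nat.lt_size.2 (hKM.trans hMn)
  have hE : 2 ^ K ≤ 2 ^ n.size := Nat.pow_le_pow_right (by norm_num) hKn.le
  have hδη : 2 ^ K * (2 * deltaParam C n.size) ≤ etaParam C n.size :=
    (Nat.mul_le_mul_right _ hE).trans (two_pow_mul_deltaParam_le hC (by omega))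
  have hΔη : 8 * (2 ^ K * etaParam C n.size) ≤ blockLen C n := by
    rw [blockLen, blockParam_eq, pow_add, mul_comm (2 ^ n.size) (2 ^ 3), mul_assoc]
    exact Nat.mul_le_mul_left _ (Nat.mul_le_mul_right _ hE)
  have hdiv := Nat.div_add_mod (N - 1 + i) (blockLen C n)
  have hr := Nat.mod_lt (N - 1 + i) (blockLen_pos C n)
  have hq : 1 ≤ (N - 1 + i) / blockLen C n :=
    (Nat.one_le_div_iff (blockLen_pos C n)).2 (by omega)
  obtain ⟨q, hq'⟩ := Nat.exists_eq_add_of_le' hq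
  rw [hq', Nat.mul_succ] at hdiv
  generalize (N - 1 + i) % blockLen C n = r at hdiv hr
  -- `u` is the last time before `N` at which the chosen coefficient is at the start of its block;
  -- `hiη` gives η < u.
  obtain ⟨u, hu⟩ : ∃ u, u + i = blockLen C n * q + blockLen C n :=
    ⟨blockLen C n * q + blockLen C n - i, by omega⟩
  have hcard := card_filter_range_le G (a := u - etaParam C n.size) (u := u)
    (d := 2 * deltaParam C n.size)
    (e := blockLen C n - 2 * deltaParam C n.size - 2 * etaParam C n.size) (N := N) ?_ ?_
  · exact count_step_arith Nat.one_le_two_pow hδη hΔη (by omega) (by omega) (by omega)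
      (ih (u - etaParam C n.size) (by omega)) hcard
  · intro t h1 h2 h3
    refine hbad t h3 (norm_lam_eq_one (Or.inr ?_))
    have : i + t = (blockLen C n - (u - t)) + blockLen C n * q := by omega
    rw [this, Nat.add_mul_mod_self_left, Nat.mod_eq_of_lt (by omega)]
    omega
  · intro t h1 h2 h3 h4
    refine hbad t h2 (norm_lam_eq_one (Or.inl ?_))
    have : i + t = (t - u) + blockLen C n * (q + 1) := by rw [Nat.mul_succ]; omega
    rw [this, Nat.add_mul_mod_self_left, Nat.mod_eq_of_lt (by omega)]
    omega

lemma not_isUFrequentlyHypercyclic_exampleCLM :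
    ¬ IsUFrequentlyHypercyclic (exampleCLM (p := p) hp hC) := by
  classical
  rintro ⟨x, hx⟩
  have hpos := hx (Metric.ball 0 (1 / 2)) Metric.isOpen_ball ⟨0, by simp⟩
  -- The count will bound the density by `(1 / 2) ^ K`, below the assumed positive density.
  obtain ⟨K, hK⟩ := exists_pow_lt_of_lt_one hpos (show (1 / 2 : ℝ) < 1 by norm_num)
  obtain ⟨M₀, hM₀⟩ := exists_forall_norm_coord_lt_one hp x
  have hE : 1 ≤ 2 ^ K := Nat.one_le_two_pow
  obtain ⟨κ₁, h1, h2⟩ := exists_orbitCoeff_gt hp hC x hx (M := 2 ^ K + M₀) (by omega)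
  refine absurd (upperDensity_le (c := (1 / 2) ^ K) (d := blockLen C (blockOf C κ₁))
    fun N => ?_) (not_le.2 hK)
  have h := two_pow_mul_card_le hp hC x (by omega : 2 ^ K ≤ 2 ^ K + M₀)
    (fun κ hκ => hM₀ κ (by omega)) h1 h2
    (fun t => t ∈ returnSet (exampleCLM hp hC) x (Metric.ball 0 (1 / 2)))
    (fun t ht => mem_ball_zero_iff.1 ht) (N + 1)
  have hset : returnSet (exampleCLM hp hC) x (Metric.ball 0 (1 / 2)) ∩ Set.Iic N =
      ((Finset.range (N + 1)).filter fun t =>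
        t ∈ returnSet (exampleCLM hp hC) x (Metric.ball 0 (1 / 2)) : Finset ℕ) := by
    ext t
    simp only [Set.mem_inter_iff, Set.mem_Iic, Finset.coe_filter, Finset.mem_range,
      Set.mem_ofPred_eq, Nat.lt_succ_iff, and_comm]
  rw [hset, Set.ncard_coe_finset]
  have h' : (2 : ℝ) ^ K * ((Finset.range (N + 1)).filter fun t =>
      t ∈ returnSet (exampleCLM hp hC) x (Metric.ball 0 (1 / 2))).card ≤
      (N + 1) + 2 ^ K * blockLen C (blockOf C κ₁) := by exact_mod_cast h
  have hpow : (0 : ℝ) < 2 ^ K := by positivity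
  refine le_of_mul_le_mul_left (h'.trans_eq ?_) hpow
  rw [one_div, inv_pow, mul_add, mul_inv_cancel_left₀ hpow.ne']

end NotUFHC

end LinearDynamics

end

/-! ### Assembly: part (a) is the inverse of the example with C = 10 -/

theorem theorem4p5 (p : ENNReal) [Fact (1 ≤ p)] (hp : p ≠ ⊤) :
    (∃ T : LinearDynamics.SeqSpace p ≃L[ℂ] LinearDynamics.SeqSpace p,
      LinearDynamics.IsUFrequentlyHypercyclic
        (T : LinearDynamics.SeqSpace p →L[ℂ] LinearDynamics.SeqSpace p) ∧
      ¬ LinearDynamics.IsUFrequentlyHypercyclic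
        (T.symm : LinearDynamics.SeqSpace p →L[ℂ] LinearDynamics.SeqSpace p)) ∧
    (∃ C₀ : ℕ, ∀ C : ℕ, C₀ ≤ C →
      ∃ (d : LinearDynamics.CTypeData)
        (S : LinearDynamics.SeqSpace p ≃L[ℂ] LinearDynamics.SeqSpace p),
        d.IsExample C ∧
        LinearDynamics.IsCTypeOperator d
          (S : LinearDynamics.SeqSpace p →L[ℂ] LinearDynamics.SeqSpace p) ∧
        ¬ LinearDynamics.IsUFrequentlyHypercyclic
          (S : LinearDynamics.SeqSpace p →L[ℂ] LinearDynamics.SeqSpace p) ∧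
        LinearDynamics.IsUFrequentlyHypercyclic
          (S.symm : LinearDynamics.SeqSpace p →L[ℂ] LinearDynamics.SeqSpace p)) :=
  ⟨⟨(LinearDynamics.exampleOp hp (le_refl 10)).symm,
      LinearDynamics.isUFrequentlyHypercyclic_inverseCLM hp le_rfl,
      LinearDynamics.not_isUFrequentlyHypercyclic_exampleCLM hp le_rfl⟩,
    10, fun C hC => ⟨LinearDynamics.exampleData C hC, LinearDynamics.exampleOp hp hC,
      LinearDynamics.exampleData_isExample C hC,
      LinearDynamics.isCTypeOperator_exampleOp hp hC,
      LinearDynamics.not_isUFrequentlyHypercyclic_exampleCLM hp hC,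
      LinearDynamics.isUFrequentlyHypercyclic_inverseCLM hp hC⟩⟩
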